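/- Let $S$ be a finite or countably infinite set and let $B=(B(x,y))_{x,y\in S}$ be a nonnegative matrix which is sub-stochastic ($\sum_y B(x,y)\le 1$ for all $x$) and irreducible (for all $x,y\in S$ there is $n\ge 1$ with $B^n(x,y)>0$). Assume A3$'$: there are $m\ge 1$, $v\in S$ and constants $c_1>0$, $c_2<\infty$ such that $$c_1B^m(v,y)\le B^m(x,y)\le c_2B^m(v,y)\qquad\text{for all }x,y\in S .$$ Put $\psi(y)=B^m(v,y)/\sum_wB^m(v,w)$ and $\delta=c_1\sum_wB^m(v,w)$, so that $B^m(x,y)=\delta\psi(y)+\tilde B(x,y)$ with $\tilde B\ge 0$. Let $X=(X_k)_{k\ge 0}$ be the Markov chain on $S\cup\{\Delta\}$, with $\Delta\notin S$ absorbing, which from a state $x\in S$ moves as follows: with probability $\delta$ the next state is drawn from $\psi$ (a regeneration), with probability $\tilde B(x,y)$ it is $y$ (no regeneration), and with probability $1-\sum_yB^m(x,y)$ it is $\Delta$. Let $T=\inf\{k\ge 0:X_k=\Delta\}$, let $\tau\ge 1$ be the first time at which a regeneration occurs ($\infty$ if there is none), let $E_x$ be the expectation for the chain started at $x$, and let $E_\psi=\sum_x\psi(x)E_x$.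 Then there is exactly one real $\theta$ with $E_\psi e^{\theta\tau}I(T>\tau)=1$. For this $\theta$ put $$\lambda_*=e^{-\theta},\qquad u_*(x)=E_xe^{\theta\tau}I(T>\tau),\qquad \eta_*(y)=E_\psi\sum_{j=0}^{\tau-1}e^{\theta j}I(X_j=y,\,T>j).$$ Then: (a) $u_*$ and $\eta_*$ are positive and finite-valued, $B^mu_*=\lambda_*u_*$ and $\eta_*B^m=\lambda_*\eta_*$, every positive finite-valued solution $u$ of $B^mu=\lambda_*u$ is a positive multiple of $u_*$, every positive finite-valued solution $\eta$ of $\eta B^m=\lambda_*\eta$ is a positive multiple of $\eta_*$, and $\sum_wu_*(w)\eta_*(w)<\infty$; (b) for all $x,y\in S$, $$B^n(x,y)\sim\lambda_*^{n/m}\,\frac{u_*(x)\eta_*(y)}{\sum_wu_*(w)\eta_*(w)}\qquad(n\to\infty);$$ (c) $Bu_*=\lambda_*^{1/m}u_*$ and $\eta_*B=\lambda_*^{1/m}\eta_*$, and $u_*$ and $\eta_*$ are, up to positive multiples, the only positive finite-valued column and row eigenvectors of $B$ for the eigenvalue $\lambda_*^{1/m}$. -/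

import Mathlib

open MeasureTheory ProbabilityTheory Filter Topology
open scoped ENNReal

noncomputable section

namespace PerronFrobenius

variable {S : Type*}

/-- A sub-stochastic matrix on `S`: nonnegative entries, every row sum at most one. -/
structure IsSubstochastic (Q : S → S → ℝ) : Prop where
  nonneg : ∀ x y, 0 ≤ Q x y
  summable : ∀ x, Summable (Q x)
  tsum_le_one : ∀ x, ∑' y, Q x y ≤ 1

open Classical in
/-- Powers of a (possibly infinite) matrix. -/
def matPow (Q : S → S → ℝ) : ℕ → S → S → ℝ
  | 0 => fun x y => if x = y then 1 else 0
  | n + 1 => fun x y => ∑' w, Q x w * matPow Q n w y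

/-- `Q` is irreducible: every state leads to every state in at least one step. -/
def IsIrred (Q : S → S → ℝ) : Prop :=
  ∀ x y, ∃ n : ℕ, 1 ≤ n ∧ 0 < matPow Q n x y

/-- All the rows of `Q` lie between the multiples `c₁` and `c₂` of the row of `v`, with `c₁ > 0`. -/
structure RowsComparable (Q : S → S → ℝ) (v : S) (c₁ c₂ : ℝ) : Prop where
  pos : 0 < c₁
  lower : ∀ x y, c₁ * Q v y ≤ Q x y
  upper : ∀ x y, Q x y ≤ c₂ * Q v y

theorem IsSubstochastic.le_one {Q : S → S → ℝ} (hQ : IsSubstochastic Q) (x y : S) :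
    Q x y ≤ 1 :=
  ((hQ.summable x).le_tsum y fun w _ => hQ.nonneg x w).trans (hQ.tsum_le_one x)

/-- Powers of a sub-stochastic matrix are sub-stochastic. -/
theorem IsSubstochastic.pow {Q : S → S → ℝ} (hQ : IsSubstochastic Q) (n : ℕ) :
    IsSubstochastic (matPow Q n) := by
  classical
  induction n with
  | zero =>
    have h : ∀ x : S, HasSum (matPow Q 0 x) 1 := by
      intro x
      have := hasSum_ite_eq x (1 : ℝ)
      simpa [matPow, eq_comm] using this
    refine ⟨fun x y => ?_, fun x => (h x).summable, fun x => (h x).tsum_eq.le⟩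
    simp only [matPow]
    split_ifs <;> norm_num
  | succ n ih =>
    have hs : ∀ x y, Summable fun w => Q x w * matPow Q n w y := fun x y =>
      Summable.of_nonneg_of_le (fun w => mul_nonneg (hQ.nonneg x w) (ih.nonneg w y))
        (fun w => mul_le_of_le_one_right (hQ.nonneg x w) (ih.le_one w y)) (hQ.summable x)
    have hnn : ∀ x y, 0 ≤ matPow Q (n + 1) x y := fun x y =>
      tsum_nonneg fun w => mul_nonneg (hQ.nonneg x w) (ih.nonneg w y)
    have hfin : ∀ x (s : Finset S), ∑ y ∈ s, matPow Q (n + 1) x y ≤ 1 := by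
      intro x s
      have h1 : ∑ y ∈ s, matPow Q (n + 1) x y = ∑' w, ∑ y ∈ s, Q x w * matPow Q n w y :=
        (Summable.tsum_finsetSum fun y _ => hs x y).symm
      rw [h1]
      refine le_trans (Summable.tsum_le_tsum (fun w => ?_) (summable_sum fun y _ => hs x y)
        (hQ.summable x)) (hQ.tsum_le_one x)
      rw [← Finset.mul_sum]
      refine mul_le_of_le_one_right (hQ.nonneg x w) ?_
      exact ((ih.summable w).sum_le_tsum s fun y _ => ih.nonneg w y).trans (ih.tsum_le_one w)
    exact ⟨hnn, fun x => summable_of_sum_le (hnn x) (hfin x),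
      fun x => Real.tsum_le_of_sum_le (hnn x) (hfin x)⟩

/-! ### The regeneration distribution and the killed chain with randomized regenerations -/

/-- The regeneration distribution: the normalized row of `v`. -/
def psi (Q : S → S → ℝ) (v y : S) : ℝ := Q v y / ∑' w, Q v w

/-- The probability `δ` of a regeneration in one step. -/
def delta (Q : S → S → ℝ) (v : S) (c₁ : ℝ) : ℝ := c₁ * ∑' w, Q v w

theorem delta_mul_psi {Q : S → S → ℝ} (hQ : IsSubstochastic Q) (v y : S) (c₁ : ℝ) :
    delta Q v c₁ * psi Q v y = c₁ * Q v y := by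
  unfold delta psi
  by_cases h : ∑' w, Q v w = 0
  · have h0 : Q v y ≤ 0 := h ▸ (hQ.summable v).le_tsum y fun w _ => hQ.nonneg v w
    rw [h, le_antisymm h0 (hQ.nonneg v y)]
    simp
  · field_simp

/-- States of the killed chain: `none` is the cemetery `Δ`; `some (y, b)` says that the chain is
at `y`, and `b = true` says that this position was just drawn from `psi` (a regeneration). -/
def SplitState (S : Type*) : Type _ := Option (S × Bool)

instance : MeasurableSpace (SplitState S) := ⊤

instance : DiscreteMeasurableSpace (SplitState S) := ⟨fun _ => trivial⟩

instance [Countable S] : Countable (SplitState S) :=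
  inferInstanceAs (Countable (Option (S × Bool)))

/-- One-step probabilities out of the state `x ∈ S`: with probability `δ` the next state is drawn
from `psi` (a regeneration), with probability `Q x y - δ ψ(y)` it is `y` (no regeneration), with
the remaining probability the chain dies. -/
def stepWeight (Q : S → S → ℝ) (v : S) (c₁ : ℝ) (x : S) : Option (S × Bool) → ℝ≥0∞
  | none => ENNReal.ofReal (1 - ∑' y, Q x y)
  | some (y, true) => ENNReal.ofReal (delta Q v c₁ * psi Q v y)
  | some (y, false) => ENNReal.ofReal (Q x y - delta Q v c₁ * psi Q v y)

theorem tsum_stepWeight {Q : S → S → ℝ} (hQ : IsSubstochastic Q) {v : S} {c₁ c₂ : ℝ}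
    (h : RowsComparable Q v c₁ c₂) (x : S) : ∑' s, stepWeight Q v c₁ x s = 1 := by
  have h1 : ∑' s, stepWeight Q v c₁ x s
      = stepWeight Q v c₁ x none + ∑' p : S × Bool, stepWeight Q v c₁ x (some p) := by
    rw [← (Equiv.optionEquivSumPUnit.{0} (S × Bool)).symm.tsum_eq,
      ENNReal.summable.tsum_sum ENNReal.summable, add_comm]
    simp
  have h2 : ∑' p : S × Bool, stepWeight Q v c₁ x (some p) = ENNReal.ofReal (∑' y, Q x y) := by
    rw [ENNReal.tsum_prod', ENNReal.ofReal_tsum_of_nonneg (hQ.nonneg x) (hQ.summable x)]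
    refine tsum_congr fun y => ?_
    have h0 : 0 ≤ c₁ * Q v y := mul_nonneg h.pos.le (hQ.nonneg v y)
    rw [tsum_fintype, Fintype.sum_bool]
    simp only [stepWeight, delta_mul_psi hQ]
    rw [← ENNReal.ofReal_add h0 (sub_nonneg.2 (h.lower x y))]
    congr 1
    ring
  rw [h1, h2]
  simp only [stepWeight]
  rw [← ENNReal.ofReal_add (sub_nonneg.2 (hQ.tsum_le_one x)) (tsum_nonneg (hQ.nonneg x))]
  simp

/-- The one-step law from a state; the cemetery is absorbing. -/
def stepLaw {Q : S → S → ℝ} (hQ : IsSubstochastic Q) {v : S} {c₁ c₂ : ℝ}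
    (h : RowsComparable Q v c₁ c₂) : Option (S × Bool) → PMF (SplitState S)
  | none => PMF.pure none
  | some (x, _) => ⟨stepWeight Q v c₁ x, tsum_stepWeight hQ h x ▸ ENNReal.summable.hasSum⟩

/-- The transition kernel of the chain. -/
def stepKernel {Q : S → S → ℝ} (hQ : IsSubstochastic Q) {v : S} {c₁ c₂ : ℝ}
    (h : RowsComparable Q v c₁ c₂) : Kernel (SplitState S) (SplitState S) where
  toFun s := (stepLaw hQ h s).toMeasure
  measurable' := Measurable.of_discrete

instance {Q : S → S → ℝ} (hQ : IsSubstochastic Q) {v : S} {c₁ c₂ : ℝ}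
    (h : RowsComparable Q v c₁ c₂) : IsMarkovKernel (stepKernel hQ h) :=
  ⟨fun s => inferInstanceAs (IsProbabilityMeasure (stepLaw hQ h s).toMeasure)⟩

/-- `P_x`: the law on path space of the Markov chain with these transitions started at `x`. -/
def pathLaw {Q : S → S → ℝ} (hQ : IsSubstochastic Q) {v : S} {c₁ c₂ : ℝ}
    (h : RowsComparable Q v c₁ c₂) (x : S) : Measure (ℕ → SplitState S) :=
  Kernel.trajMeasure (X := fun _ => SplitState S)
    (Measure.dirac (some (x, false) : SplitState S))
    fun n => (stepKernel hQ h).comap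
      (fun path : (i : Finset.Iic n) → SplitState S => path ⟨n, Finset.mem_Iic.2 le_rfl⟩)
      (measurable_pi_apply _)

/-- `E_x f` for a nonnegative functional `f` of the path. -/
def expect {Q : S → S → ℝ} (hQ : IsSubstochastic Q) {v : S} {c₁ c₂ : ℝ}
    (h : RowsComparable Q v c₁ c₂) (x : S) (f : (ℕ → SplitState S) → ℝ≥0∞) : ℝ≥0∞ :=
  ∫⁻ ω, f ω ∂(pathLaw hQ h x)

/-- `E_ψ f = ∑ₓ ψ(x) E_x f`. -/
def expectPsi {Q : S → S → ℝ} (hQ : IsSubstochastic Q) {v : S} {c₁ c₂ : ℝ}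
    (h : RowsComparable Q v c₁ c₂) (f : (ℕ → SplitState S) → ℝ≥0∞) : ℝ≥0∞ :=
  ∑' x, ENNReal.ofReal (psi Q v x) * expect hQ h x f

/-- `T`: the time at which the chain dies (`⊤` if it never does). -/
def killTime (ω : ℕ → SplitState S) : ℕ∞ :=
  ⨅ (n : ℕ) (_ : ω n = none), (n : ℕ∞)

/-- `τ`: the first time `n ≥ 1` at which the chain regenerates (`⊤` if it never does). -/
def regenTime (ω : ℕ → SplitState S) : ℕ∞ :=
  ⨅ (n : ℕ) (_ : 1 ≤ n ∧ ∃ y, ω n = some (y, true)), (n : ℕ∞)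

open Classical in
/-- The path functional `e^{θ τ} I(T > τ)`. -/
def expRegen (θ : ℝ) (ω : ℕ → SplitState S) : ℝ≥0∞ :=
  if regenTime ω < killTime ω then ENNReal.ofReal (Real.exp (θ * (regenTime ω).toNat)) else 0

open Classical in
/-- The path functional `∑_{j=0}^{τ-1} e^{θ j} I(X_j = y, T > j)`. -/
def expOccupation (θ : ℝ) (y : S) (ω : ℕ → SplitState S) : ℝ≥0∞ :=
  ∑' j : ℕ, if (j : ℕ∞) < regenTime ω ∧ (∃ b, ω j = some (y, b)) ∧ (j : ℕ∞) < killTime ω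
    then ENNReal.ofReal (Real.exp (θ * j)) else 0

/-- `u_*(x) = E_x e^{θ τ} I(T > τ)`. -/
def uStar {Q : S → S → ℝ} (hQ : IsSubstochastic Q) {v : S} {c₁ c₂ : ℝ}
    (h : RowsComparable Q v c₁ c₂) (θ : ℝ) (x : S) : ℝ≥0∞ :=
  expect hQ h x (expRegen θ)

/-- `η_*(y) = E_ψ ∑_{j=0}^{τ-1} e^{θ j} I(X_j = y, T > j)`. -/
def etaStar {Q : S → S → ℝ} (hQ : IsSubstochastic Q) {v : S} {c₁ c₂ : ℝ}
    (h : RowsComparable Q v c₁ c₂) (θ : ℝ) (y : S) : ℝ≥0∞ :=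
  expectPsi hQ h (expOccupation θ y)

/-! ### Eigenvectors -/

/-- `u` is a positive column eigenvector: `Q u = lam u`. -/
def IsPosColEigenvector (Q : S → S → ℝ) (lam : ℝ) (u : S → ℝ) : Prop :=
  (∀ x, 0 < u x) ∧ ∀ x, HasSum (fun y => Q x y * u y) (lam * u x)

/-- `η` is a positive row eigenvector: `η Q = lam η`. -/
def IsPosRowEigenvector (Q : S → S → ℝ) (lam : ℝ) (η : S → ℝ) : Prop :=
  (∀ y, 0 < η y) ∧ ∀ y, HasSum (fun x => η x * Q x y) (lam * η y)

/-- `u` is, up to positive multiples, the only positive column eigenvector of `Q` for `lam`. -/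
def IsUniquePosColEigenvector (Q : S → S → ℝ) (lam : ℝ) (u : S → ℝ) : Prop :=
  IsPosColEigenvector Q lam u ∧
    ∀ u', IsPosColEigenvector Q lam u' → ∃ a : ℝ, 0 < a ∧ ∀ x, u' x = a * u x

/-- `η` is, up to positive multiples, the only positive row eigenvector of `Q` for `lam`. -/
def IsUniquePosRowEigenvector (Q : S → S → ℝ) (lam : ℝ) (η : S → ℝ) : Prop :=
  IsPosRowEigenvector Q lam η ∧
    ∀ η', IsPosRowEigenvector Q lam η' → ∃ a : ℝ, 0 < a ∧ ∀ y, η' y = a * η y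

end PerronFrobenius

end

open PerronFrobenius

/-! Put Q = B^m and split Q = δ 1⊗ψ + A, where A is the part without regeneration. With z = e^θ, the
expectation defining u_* is the Neumann series δz ∑ z^k A^k 1, the one defining η_* is ∑ z^k ψA^k,
and the equation for θ says that the renewal function R(z) = δz ∑ z^k ψA^k 1 equals 1 (`uStar_eq`,
`etaStar_eq`, `expectPsi_expRegen_eq`). This identification is the only place where path space
enters; afterwards everything is about matrices with entries in [0, ∞], where series may be
rearranged freely.

The equation Qu = z⁻¹u reads u = δz(ψu)1 + zAu, so a solution must be a multiple of the Neumann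
series, and R(z) = 1 is the consistency condition; rows are dual. Uniqueness holds because the bound
A ≤ c 1⊗ψ dominates any solution by a multiple of the source term, so the remainder z^n A^n u
vanishes (`eq_smul_neumann`).

The same bound gives a root of R = 1. If R is finite at z, then w = ∑ z^k A^k 1 is bounded, hence
zAw = w - 1 ≤ ρw with ρ < 1, and the series still converges slightly beyond z
(`exists_lt_pairing_ne_top`). Thus R cannot jump from below 1 to ∞, and the intermediate value
theorem applies; strict monotonicity makes the root unique.

Since B commutes with B^m, Bu_* is again a positive eigenvector of B^m, hence a multiple of u_*,
with factor the m-th root of λ_* (`IsUniquePosEigenvector.root`).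

For the asymptotics, B^m ≥ ε u_*⊗η_* because u_* is bounded and η_* ≤ Hψ. On functions orthogonal to
η_*, subtracting this rank-one part changes nothing, so B^m contracts the norm sup |w|/u_* by a
factor strictly below λ_*. Applied to a column of B^n minus its expected limit, this gives geometric
convergence (`tendsto_matPow_div_pow`). No aperiodicity assumption is needed: irreducibility and
comparable rows make every entry of B^m positive (`IsIrred.matPow_pos`). -/

noncomputable section

namespace PerronFrobenius

variable {S : Type*}

/-! ### Nonnegative matrices acting on nonnegative functions -/

/-- The action of a matrix with entries in `[0, ∞]` on functions. Acting on row vectors is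
acting by the transpose. -/
def act (A : S → S → ℝ≥0∞) : (S → ℝ≥0∞) →ₗ[ℝ≥0∞] (S → ℝ≥0∞) where
  toFun u x := ∑' y, A x y * u y
  map_add' u w := by
    funext x
    simp [mul_add, ENNReal.tsum_add]
  map_smul' a u := by
    funext x
    simp only [Pi.smul_apply, smul_eq_mul, RingHom.id_apply, ← ENNReal.tsum_mul_left]
    exact tsum_congr fun y => by ring

theorem act_apply (A : S → S → ℝ≥0∞) (u : S → ℝ≥0∞) (x : S) :
    act A u x = ∑' y, A x y * u y := rfl

/-- The transposed matrix. -/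
def transp {R : Type*} (A : S → S → R) : S → S → R := fun x y => A y x

/-- The pairing of a row vector and a column vector. -/
def pairing (μ u : S → ℝ≥0∞) : ℝ≥0∞ := ∑' x, μ x * u x

theorem pairing_comm (μ u : S → ℝ≥0∞) : pairing μ u = pairing u μ :=
  tsum_congr fun _ => mul_comm _ _

theorem act_mono (A : S → S → ℝ≥0∞) {u w : S → ℝ≥0∞} (h : u ≤ w) : act A u ≤ act A w :=
  fun _ => ENNReal.tsum_le_tsum fun y => mul_le_mul_right (h y) _

theorem act_pow_mono (A : S → S → ℝ≥0∞) (n : ℕ) {u w : S → ℝ≥0∞} (h : u ≤ w) :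
    (act A ^ n) u ≤ (act A ^ n) w := by
  induction n with
  | zero => simpa using h
  | succ n ih =>
    simp only [pow_succ', Module.End.mul_apply]
    exact act_mono A ih

theorem act_tsum {ι : Type*} (A : S → S → ℝ≥0∞) (f : ι → S → ℝ≥0∞) (x : S) :
    act A (fun y => ∑' i, f i y) x = ∑' i, act A (f i) x := by
  simp only [act_apply, ← ENNReal.tsum_mul_left]
  exact ENNReal.tsum_comm

theorem pairing_smul (a : ℝ≥0∞) (μ u : S → ℝ≥0∞) : pairing μ (a • u) = a * pairing μ u := by
  simp only [pairing, ← ENNReal.tsum_mul_left, Pi.smul_apply, smul_eq_mul]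
  exact tsum_congr fun y => by ring

theorem pairing_tsum {ι : Type*} (μ : S → ℝ≥0∞) (f : ι → S → ℝ≥0∞) :
    pairing μ (fun y => ∑' i, f i y) = ∑' i, pairing μ (f i) := by
  simp only [pairing, ← ENNReal.tsum_mul_left]
  exact ENNReal.tsum_comm

theorem pairing_mono (μ : S → ℝ≥0∞) {u w : S → ℝ≥0∞} (h : u ≤ w) : pairing μ u ≤ pairing μ w :=
  ENNReal.tsum_le_tsum fun y => mul_le_mul_right (h y) _

theorem pairing_act (A : S → S → ℝ≥0∞) (μ u : S → ℝ≥0∞) :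
    pairing μ (act A u) = pairing (act (transp A) μ) u := by
  simp only [pairing, act_apply, ← ENNReal.tsum_mul_left, ← ENNReal.tsum_mul_right, transp]
  rw [ENNReal.tsum_comm]
  exact tsum_congr fun y => tsum_congr fun x => by ring

theorem pairing_act_pow (A : S → S → ℝ≥0∞) (n : ℕ) (μ u : S → ℝ≥0∞) :
    pairing μ ((act A ^ n) u) = pairing ((act (transp A) ^ n) μ) u := by
  induction n generalizing μ with
  | zero => simp
  | succ n ih =>
    rw [pow_succ', Module.End.mul_apply, pairing_act, ih, pow_succ, Module.End.mul_apply]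

open Classical in
theorem pairing_single (μ : S → ℝ≥0∞) (y : S) : pairing μ (Pi.single y 1) = μ y := by
  rw [pairing, tsum_eq_single y fun x hx => by simp [Pi.single_eq_of_ne hx]]
  simp

/-- The Neumann series `∑ₖ zᵏ Aᵏ g`. -/
def neumann (z : ℝ≥0∞) (A : S → S → ℝ≥0∞) (g : S → ℝ≥0∞) : S → ℝ≥0∞ :=
  fun x => ∑' k : ℕ, z ^ k * (act A ^ k) g x

theorem neumann_eq (z : ℝ≥0∞) (A : S → S → ℝ≥0∞) (g : S → ℝ≥0∞) :
    neumann z A g = g + z • act A (neumann z A g) := by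
  funext x
  have h : act A (neumann z A g) x = ∑' k : ℕ, z ^ k * (act A ^ (k + 1)) g x := by
    have h1 : neumann z A g = fun y => ∑' k : ℕ, (z ^ k • (act A ^ k) g) y := rfl
    rw [h1, act_tsum]
    refine tsum_congr fun k => ?_
    rw [map_smul, pow_succ' (act A), Module.End.mul_apply]
    rfl
  rw [Pi.add_apply, Pi.smul_apply, h, smul_eq_mul, ← ENNReal.tsum_mul_left, neumann,
    tsum_eq_zero_add' ENNReal.summable]
  simp only [pow_zero, one_mul, Module.End.one_apply]
  congr 1
  exact tsum_congr fun k => by rw [pow_succ' z]; ring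

theorem le_neumann (z : ℝ≥0∞) (A : S → S → ℝ≥0∞) (g : S → ℝ≥0∞) : g ≤ neumann z A g := by
  rw [neumann_eq]
  exact le_self_add

theorem pairing_neumann (z : ℝ≥0∞) (A : S → S → ℝ≥0∞) (μ g : S → ℝ≥0∞) :
    pairing μ (neumann z A g) = ∑' k : ℕ, z ^ k * pairing μ ((act A ^ k) g) := by
  have h1 : neumann z A g = fun y => ∑' k : ℕ, (z ^ k • (act A ^ k) g) y := rfl
  rw [h1, pairing_tsum]
  exact tsum_congr fun k => pairing_smul _ _ _

theorem pairing_neumann_transp (z : ℝ≥0∞) (A : S → S → ℝ≥0∞) (μ g : S → ℝ≥0∞) :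
    pairing g (neumann z (transp A) μ) = pairing μ (neumann z A g) := by
  rw [pairing_neumann, pairing_neumann]
  refine tsum_congr fun k => ?_
  rw [pairing_act_pow, pairing_comm μ]
  rfl

/-- A solution of `f = a e + z A f` which is dominated by `e` is given by the Neumann series. -/
theorem eq_smul_neumann {z a M : ℝ≥0∞} {A : S → S → ℝ≥0∞} {e f : S → ℝ≥0∞}
    (hf : f = a • e + z • act A f) (ha : a ≠ ∞) (hM : M ≠ ∞) (hfe : f ≤ M • e)
    (hfin : ∀ x, neumann z A e x ≠ ∞) : f = a • neumann z A e := by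
  -- Substituting the equation into itself n times leaves a remainder, which is at most M times the
  -- n-th term of a convergent series.
  have hiter : ∀ n : ℕ, ∀ x, f x = a * ∑ k ∈ Finset.range n, z ^ k * (act A ^ k) e x
      + z ^ n * (act A ^ n) f x := by
    intro n
    induction n with
    | zero => simp
    | succ n ih =>
      intro x
      rw [ih x, Finset.sum_range_succ, mul_add, add_assoc]
      congr 1
      conv_lhs => rw [hf]
      rw [map_add, map_smul, map_smul, ← Module.End.mul_apply, ← pow_succ]
      simp only [Pi.add_apply, Pi.smul_apply, smul_eq_mul]
      ring
  funext x
  have hrem : Tendsto (fun n : ℕ => z ^ n * (act A ^ n) f x) atTop (𝓝 0) := by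
    have h0 : Tendsto (fun n : ℕ => M * (z ^ n * (act A ^ n) e x)) atTop (𝓝 0) := by
      have := ENNReal.Tendsto.const_mul (a := M)
        (ENNReal.tendsto_atTop_zero_of_tsum_ne_top (hfin x)) (Or.inr hM)
      simpa using this
    refine tendsto_of_tendsto_of_tendsto_of_le_of_le tendsto_const_nhds h0
      (fun _ => zero_le) fun n => ?_
    have := act_pow_mono A n hfe x
    rw [map_smul, Pi.smul_apply, smul_eq_mul] at this
    calc z ^ n * (act A ^ n) f x ≤ z ^ n * (M * (act A ^ n) e x) := mul_le_mul_right this _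
      _ = _ := by ring
  have hsum : Tendsto (fun n : ℕ => ∑ k ∈ Finset.range n, z ^ k * (act A ^ k) e x) atTop
      (𝓝 (neumann z A e x)) := ENNReal.tendsto_nat_tsum _
  have h2 := (ENNReal.Tendsto.const_mul (a := a) hsum (Or.inr ha)).add hrem
  rw [add_zero] at h2
  exact tendsto_nhds_unique (tendsto_const_nhds.congr fun n => hiter n x) h2

section

/-! ### The renewal equation -/

/-- The non-regenerative part `A` of a matrix, whose rows are dominated by the regeneration
distribution `ψ`. -/
structure IsRegenerative (A : S → S → ℝ≥0∞) (ψ : S → ℝ≥0∞) (c : ℝ≥0∞) : Prop where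
  tsum_eq_one : ∑' x, ψ x = 1
  le : ∀ x y, A x y ≤ c * ψ y
  act_one_le : act A 1 ≤ 1
  ne_top : c ≠ ∞

/-- The generating function `∑ₖ δ zᵏ⁺¹ ψ Aᵏ 1` of the defective regeneration time. -/
def renewal (A : S → S → ℝ≥0∞) (ψ : S → ℝ≥0∞) (δ z : ℝ≥0∞) : ℝ≥0∞ :=
  δ * z * pairing ψ (neumann z A 1)

variable {A : S → S → ℝ≥0∞} {ψ : S → ℝ≥0∞} {c δ z : ℝ≥0∞}

theorem renewal_eq_tsum (A : S → S → ℝ≥0∞) (ψ : S → ℝ≥0∞) (δ z : ℝ≥0∞) :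
    renewal A ψ δ z = ∑' k : ℕ, δ * z ^ (k + 1) * pairing ψ ((act A ^ k) 1) := by
  rw [renewal, pairing_neumann, ← ENNReal.tsum_mul_left]
  exact tsum_congr fun k => by ring

namespace IsRegenerative

theorem pairing_one (h : IsRegenerative A ψ c) : pairing ψ 1 = 1 := by
  simpa [pairing] using h.tsum_eq_one

theorem act_pow_one_le (h : IsRegenerative A ψ c) (k : ℕ) : (act A ^ k) 1 ≤ 1 := by
  induction k with
  | zero => simp
  | succ k ih =>
    rw [pow_succ', Module.End.mul_apply]
    exact (act_mono A ih).trans h.act_one_le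

theorem pairing_pow_le (h : IsRegenerative A ψ c) (k : ℕ) : pairing ψ ((act A ^ k) 1) ≤ 1 :=
  (pairing_mono ψ (h.act_pow_one_le k)).trans h.pairing_one.le

/-- The domination of the rows by ψ turns one scalar, the ψ-mean, into a bound uniform in the
starting state. -/
theorem act_le (h : IsRegenerative A ψ c) (u : S → ℝ≥0∞) (x : S) :
    act A u x ≤ c * pairing ψ u := by
  rw [act_apply, pairing, ← ENNReal.tsum_mul_left]
  refine ENNReal.tsum_le_tsum fun y => ?_
  rw [← mul_assoc]
  exact mul_le_mul_left (h.le x y) _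

theorem one_le_pairing (h : IsRegenerative A ψ c) : 1 ≤ pairing ψ (neumann z A 1) := by
  rw [← h.pairing_one]
  exact pairing_mono ψ (le_neumann z A 1)

/-- This is the term k = 0 of the series; it keeps the root of the renewal equation finite. -/
theorem le_renewal (h : IsRegenerative A ψ c) : δ * z ≤ renewal A ψ δ z :=
  le_mul_of_one_le_right' h.one_le_pairing

theorem renewal_zero : renewal A ψ δ 0 = 0 := by simp [renewal]

theorem pairing_neumann_zero (h : IsRegenerative A ψ c) : pairing ψ (neumann 0 A 1) = 1 := by
  rw [neumann_eq, zero_smul, add_zero, h.pairing_one]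

theorem neumann_le (h : IsRegenerative A ψ c) (x : S) :
    neumann z A 1 x ≤ 1 + z * (c * pairing ψ (neumann z A 1)) := by
  rw [neumann_eq, Pi.add_apply, Pi.smul_apply, smul_eq_mul]
  refine add_le_add_right (mul_le_mul_right ?_ z) _
  rw [← neumann_eq]
  exact h.act_le _ x

theorem neumann_ne_top (h : IsRegenerative A ψ c) (hz : z ≠ ∞)
    (hfin : pairing ψ (neumann z A 1) ≠ ∞) (x : S) : neumann z A 1 x ≠ ∞ :=
  ne_top_of_le_ne_top (ENNReal.add_ne_top.2 ⟨ENNReal.one_ne_top,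
    ENNReal.mul_ne_top hz (ENNReal.mul_ne_top h.ne_top hfin)⟩) (h.neumann_le x)

/-- The series `∑ₖ zᵏ ψ Aᵏ 1` does not converge on the boundary of its disc of convergence. -/
theorem exists_lt_pairing_ne_top (h : IsRegenerative A ψ c) (hz : z ≠ ∞)
    (hfin : pairing ψ (neumann z A 1) ≠ ∞) :
    ∃ r, z < r ∧ r ≠ ∞ ∧ pairing ψ (neumann r A 1) ≠ ∞ := by
  -- The radius found below is a multiple of z, so z = 0 is treated apart, by comparison with a
  -- geometric series.
  rcases eq_or_ne z 0 with rfl | hz0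
  · refine ⟨2⁻¹, by simp, by simp, ?_⟩
    rw [pairing_neumann]
    refine ne_top_of_le_ne_top (b := ∑' k : ℕ, (2⁻¹ : ℝ≥0∞) ^ k) ?_
      (ENNReal.tsum_le_tsum fun k => mul_le_of_le_one_right' (h.pairing_pow_le k))
    rw [ENNReal.tsum_geometric]
    simp
  set w := neumann z A 1 with hw
  set H := 1 + z * (c * pairing ψ w) with hH
  have hHtop : H ≠ ∞ := ENNReal.add_ne_top.2 ⟨ENNReal.one_ne_top,
    ENNReal.mul_ne_top hz (ENNReal.mul_ne_top h.ne_top hfin)⟩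
  have hH1 : 1 ≤ H := le_self_add
  have hH0 : H ≠ 0 := (zero_lt_one.trans_le hH1).ne'
  set ρ := 1 - H⁻¹ with hρ
  -- Since w ≤ H, the constant 1 is at least w/H, and zAw = w - 1 ≤ (1 - 1/H)w.
  have hρ1 : ρ < 1 := ENNReal.sub_lt_self (by simp) (by simp) (ENNReal.inv_ne_zero.2 hHtop)
  have hstep : z • act A w ≤ ρ • w := by
    intro x
    have hwx : w x ≠ ∞ := h.neumann_ne_top hz hfin x
    have h1 : w x = 1 + (z • act A w) x := by
      conv_lhs => rw [hw, neumann_eq]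
      rfl
    have h2 : H⁻¹ * w x ≤ 1 := by
      calc H⁻¹ * w x ≤ H⁻¹ * H := mul_le_mul_right (h.neumann_le x) _
        _ = 1 := ENNReal.inv_mul_cancel hH0 hHtop
    have h3 : (z • act A w) x = w x - 1 := by
      rw [h1, ENNReal.add_sub_cancel_left ENNReal.one_ne_top]
    rw [h3, Pi.smul_apply, smul_eq_mul, hρ, ENNReal.sub_mul fun _ _ => hwx, one_mul]
    exact tsub_le_tsub_left h2 _
  have hpow : ∀ k : ℕ, z ^ k • (act A ^ k) w ≤ ρ ^ k • w := by
    intro k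
    induction k with
    | zero => simp
    | succ k ih =>
      calc z ^ (k + 1) • (act A ^ (k + 1)) w = z • act A (z ^ k • (act A ^ k) w) := by
            rw [map_smul, smul_smul, pow_succ' (act A), Module.End.mul_apply, pow_succ']
        _ ≤ z • act A (ρ ^ k • w) := fun x => mul_le_mul_right (act_mono A ih x) z
        _ = ρ ^ k • (z • act A w) := by rw [map_smul, smul_comm]
        _ ≤ ρ ^ k • (ρ • w) := fun x => mul_le_mul_right (hstep x) _
        _ = ρ ^ (k + 1) • w := by rw [smul_smul, pow_succ]
  -- At radius tz the k-th term is at most (tρ)^k ψw, a geometric series.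
  obtain ⟨t, ht1, htρ⟩ : ∃ t : ℝ≥0∞, 1 < t ∧ t < ρ⁻¹ := exists_between (ENNReal.one_lt_inv.2 hρ1)
  have httop : t ≠ ∞ := htρ.ne_top
  have htρ1 : t * ρ < 1 := by
    rcases eq_or_ne ρ 0 with h0 | h0
    · simp [h0]
    · calc t * ρ < ρ⁻¹ * ρ := ENNReal.mul_lt_mul_left h0 (hρ1.trans ENNReal.one_lt_top).ne htρ
        _ = 1 := ENNReal.inv_mul_cancel h0 (hρ1.trans ENNReal.one_lt_top).ne
  refine ⟨t * z, ?_, ENNReal.mul_ne_top httop hz, ?_⟩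
  · calc z = 1 * z := (one_mul z).symm
      _ < t * z := ENNReal.mul_lt_mul_left hz0 hz ht1
  · rw [pairing_neumann]
    refine ne_top_of_le_ne_top (b := ∑' k : ℕ, (t * ρ) ^ k * pairing ψ w) ?_
      (ENNReal.tsum_le_tsum fun k => ?_)
    · rw [ENNReal.tsum_mul_right, ENNReal.tsum_geometric]
      refine ENNReal.mul_ne_top (ENNReal.inv_ne_top.2 ?_) hfin
      exact (tsub_pos_of_lt htρ1).ne'
    · have h1 : (act A ^ k) 1 ≤ (act A ^ k) w := act_pow_mono A k (le_neumann z A 1)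
      calc (t * z) ^ k * pairing ψ ((act A ^ k) 1)
          ≤ (t * z) ^ k * pairing ψ ((act A ^ k) w) := mul_le_mul_right (pairing_mono ψ h1) _
        _ = t ^ k * pairing ψ (z ^ k • (act A ^ k) w) := by rw [pairing_smul]; ring
        _ ≤ t ^ k * pairing ψ (ρ ^ k • w) := mul_le_mul_right (pairing_mono ψ (hpow k)) _
        _ = (t * ρ) ^ k * pairing ψ w := by rw [pairing_smul]; ring

theorem continuous_renewal_term (hδ : δ ≠ ∞) (h : IsRegenerative A ψ c) (k : ℕ) :
    Continuous fun z : ℝ≥0∞ => δ * z ^ (k + 1) * pairing ψ ((act A ^ k) 1) := by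
  have h1 : pairing ψ ((act A ^ k) 1) ≠ ∞ := ne_top_of_le_ne_top (by simp) (h.pairing_pow_le k)
  exact (ENNReal.continuous_mul_const h1).comp
    ((ENNReal.continuous_const_mul hδ).comp (ENNReal.continuous_pow (k + 1)))

/-- Dominated convergence for counting measure, the series at r being the dominating one. -/
theorem continuousOn_renewal (h : IsRegenerative A ψ c) (hδ : δ ≠ ∞) {r : ℝ≥0∞}
    (hr : renewal A ψ δ r ≠ ∞) : ContinuousOn (renewal A ψ δ) (Set.Iic r) := by
  intro t ht
  have hrw : renewal A ψ δ = fun s => ∫⁻ k, δ * s ^ (k + 1) * pairing ψ ((act A ^ k) 1)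
      ∂(Measure.count : Measure ℕ) := by
    funext s
    rw [lintegral_count, renewal_eq_tsum]
  rw [ContinuousWithinAt, hrw]
  refine tendsto_lintegral_filter_of_dominated_convergence
    (fun k => δ * r ^ (k + 1) * pairing ψ ((act A ^ k) 1)) (.of_forall fun _ => .of_discrete) ?_ ?_ ?_
  · filter_upwards [self_mem_nhdsWithin] with s hs
    refine .of_forall fun k => ?_
    have : s ≤ r := hs
    gcongr
  · rwa [lintegral_count, ← renewal_eq_tsum]
  · exact .of_forall fun k => ((continuous_renewal_term hδ h k).tendsto t).mono_left
      nhdsWithin_le_nhds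

theorem exists_renewal_eq_one (h : IsRegenerative A ψ c) (hδ0 : δ ≠ 0) (hδ : δ ≠ ∞) :
    ∃ z, z ≠ 0 ∧ z ≠ ∞ ∧ renewal A ψ δ z = 1 := by
  suffices ∃ z, renewal A ψ δ z = 1 by
    obtain ⟨z, hz⟩ := this
    refine ⟨z, ?_, ?_, hz⟩
    · rintro rfl
      simp [renewal_zero] at hz
    · rintro rfl
      have := h.le_renewal (δ := δ) (z := ∞)
      rw [hz, ENNReal.mul_top hδ0] at this
      simp at this
  -- A sum of nonnegative continuous terms is lower semicontinuous even where it may be infinite, so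
  -- the largest z with value at most 1 exists.
  have hclosed : IsClosed {z | renewal A ψ δ z ≤ 1} := by
    have : LowerSemicontinuous (renewal A ψ δ) := by
      have h1 : renewal A ψ δ = fun z => ∑' k : ℕ, δ * z ^ (k + 1) * pairing ψ ((act A ^ k) 1) :=
        funext fun z => renewal_eq_tsum A ψ δ z
      rw [h1]
      exact lowerSemicontinuous_tsum fun k => (continuous_renewal_term hδ h k).lowerSemicontinuous
    exact this.isClosed_preimage 1
  have hmem := hclosed.sSup_mem ⟨0, by simp [renewal_zero]⟩
  set z := sSup {z | renewal A ψ δ z ≤ 1} with hz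
  have hz1 : renewal A ψ δ z ≤ 1 := hmem
  have hztop : z ≠ ∞ := by
    intro ht
    have := (h.le_renewal (δ := δ) (z := z)).trans hz1
    rw [ht, ENNReal.mul_top hδ0] at this
    simp at this
  have hfin : pairing ψ (neumann z A 1) ≠ ∞ := by
    rcases eq_or_ne z 0 with h0 | h0
    · rw [h0, h.pairing_neumann_zero]
      simp
    · intro ht
      rw [renewal, ht, ENNReal.mul_top (mul_ne_zero hδ0 h0)] at hz1
      simp at hz1
  -- Beyond the supremum the value is at least 1 and at r still finite, so the value 1 is attained
  -- on [z, r].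
  obtain ⟨r, hzr, hrtop, hr⟩ := h.exists_lt_pairing_ne_top hztop hfin
  have hr1 : 1 ≤ renewal A ψ δ r := by
    by_contra hlt
    exact absurd (le_sSup (show r ∈ {z | renewal A ψ δ z ≤ 1} from (not_le.1 hlt).le)) hzr.not_ge
  have hrfin : renewal A ψ δ r ≠ ∞ := ENNReal.mul_ne_top (ENNReal.mul_ne_top hδ hrtop) hr
  obtain ⟨t, -, ht⟩ := intermediate_value_Icc hzr.le
    ((h.continuousOn_renewal hδ hrfin).mono Set.Icc_subset_Iic_self) ⟨hz1, hr1⟩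
  exact ⟨t, ht⟩

theorem eq_of_renewal_eq_one (h : IsRegenerative A ψ c) (hδ0 : δ ≠ 0) (hδ : δ ≠ ∞)
    {w : ℝ≥0∞} (hz : renewal A ψ δ z = 1) (hw : renewal A ψ δ w = 1) : z = w := by
  have key : ∀ {z w : ℝ≥0∞}, z < w → renewal A ψ δ z = 1 → renewal A ψ δ w = 1 → False := by
    intro z w hzw hz hw
    have : renewal A ψ δ z < renewal A ψ δ w := by
      rw [renewal_eq_tsum, renewal_eq_tsum]
      -- The term k = 0 is δz, already strictly increasing.
      refine ENNReal.tsum_lt_tsum (i := 0) ?_ (fun k => ?_) ?_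
      · rw [← renewal_eq_tsum, hz]
        simp
      · gcongr
      · simp only [zero_add, pow_one, pow_zero, Module.End.one_apply, h.pairing_one, mul_one]
        exact ENNReal.mul_lt_mul_right hδ0 hδ hzw
    rw [hz, hw] at this
    exact this.false
  rcases lt_trichotomy z w with hlt | heq | hlt
  · exact (key hlt hz hw).elim
  · exact heq
  · exact (key hlt hw hz).elim

end IsRegenerative

end

section

/-! ### Eigenvectors of a regenerative matrix -/

/-- The matrix `δ ψ + A`. -/
def regenMatrix (A : S → S → ℝ≥0∞) (ψ : S → ℝ≥0∞) (δ : ℝ≥0∞) : S → S → ℝ≥0∞ :=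
  fun x y => δ * ψ y + A x y

/-- The column vector `∑ₖ δ zᵏ⁺¹ Aᵏ 1`. -/
def colVec (A : S → S → ℝ≥0∞) (δ z : ℝ≥0∞) : S → ℝ≥0∞ := (δ * z) • neumann z A 1

/-- The row vector `∑ₖ zᵏ ψ Aᵏ`. -/
def rowVec (A : S → S → ℝ≥0∞) (ψ : S → ℝ≥0∞) (z : ℝ≥0∞) : S → ℝ≥0∞ :=
  neumann z (transp A) ψ

variable {A : S → S → ℝ≥0∞} {ψ : S → ℝ≥0∞} {c δ z : ℝ≥0∞}

theorem act_regenMatrix (u : S → ℝ≥0∞) :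
    act (regenMatrix A ψ δ) u = (δ * pairing ψ u) • 1 + act A u := by
  funext x
  simp only [act_apply, regenMatrix, Pi.add_apply, Pi.smul_apply, Pi.one_apply, smul_eq_mul,
    mul_one, add_mul, ENNReal.tsum_add, pairing, ← ENNReal.tsum_mul_left, mul_assoc]

theorem act_transp_regenMatrix (η : S → ℝ≥0∞) :
    act (transp (regenMatrix A ψ δ)) η = (δ * pairing η 1) • ψ + act (transp A) η := by
  funext y
  simp only [act_apply, regenMatrix, transp, Pi.add_apply, Pi.smul_apply, Pi.one_apply,
    smul_eq_mul, mul_one, add_mul, ENNReal.tsum_add, pairing, ENNReal.tsum_mul_left]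
  ring

theorem pairing_colVec : pairing ψ (colVec A δ z) = renewal A ψ δ z := by
  rw [colVec, pairing_smul, renewal]

theorem pairing_rowVec_one : pairing (rowVec A ψ z) 1 = pairing ψ (neumann z A 1) := by
  rw [pairing_comm, rowVec, pairing_neumann_transp]

theorem le_rowVec : ψ ≤ rowVec A ψ z := le_neumann _ _ _

theorem le_colVec (x : S) : δ * z ≤ colVec A δ z x :=
  le_mul_of_one_le_right' (le_neumann z A 1 x)

namespace IsRegenerative

theorem pairing_ne_top_of_renewal (hz0 : z ≠ 0) (hδ0 : δ ≠ 0) (hz : renewal A ψ δ z = 1) :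
    pairing ψ (neumann z A 1) ≠ ∞ := by
  intro ht
  rw [renewal, ht, ENNReal.mul_top (mul_ne_zero hδ0 hz0)] at hz
  simp at hz

theorem colVec_le (h : IsRegenerative A ψ c) (x : S) :
    colVec A δ z x ≤ δ * z * (1 + z * (c * pairing ψ (neumann z A 1))) :=
  mul_le_mul_right (h.neumann_le x) _

theorem act_transp_le (h : IsRegenerative A ψ c) (η : S → ℝ≥0∞) (y : S) :
    act (transp A) η y ≤ c * pairing η 1 * ψ y := by
  simp only [act_apply, pairing, Pi.one_apply, mul_one, ← ENNReal.tsum_mul_left,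
    ← ENNReal.tsum_mul_right, transp]
  refine ENNReal.tsum_le_tsum fun x => ?_
  calc A x y * η x ≤ c * ψ y * η x := mul_le_mul_left (h.le x y) _
    _ = c * η x * ψ y := by ring

theorem rowVec_le (h : IsRegenerative A ψ c) (y : S) :
    rowVec A ψ z y ≤ (1 + z * (c * pairing ψ (neumann z A 1))) * ψ y := by
  rw [rowVec, neumann_eq, Pi.add_apply, Pi.smul_apply, smul_eq_mul, add_mul, one_mul, mul_assoc]
  refine add_le_add_right (mul_le_mul_right ?_ z) _
  rw [← pairing_rowVec_one]
  exact h.act_transp_le _ y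

theorem apply_ne_top (h : IsRegenerative A ψ c) (y : S) : ψ y ≠ ∞ :=
  ne_top_of_le_ne_top (by simp [h.tsum_eq_one]) (ENNReal.le_tsum (f := ψ) y)

theorem rowVec_ne_top (h : IsRegenerative A ψ c) (hz : z ≠ ∞)
    (hfin : pairing ψ (neumann z A 1) ≠ ∞) (y : S) : rowVec A ψ z y ≠ ∞ :=
  ne_top_of_le_ne_top (ENNReal.mul_ne_top (ENNReal.add_ne_top.2 ⟨ENNReal.one_ne_top,
    ENNReal.mul_ne_top hz (ENNReal.mul_ne_top h.ne_top hfin)⟩) (h.apply_ne_top y)) (h.rowVec_le y)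

/-- The renewal equation is the normalization ψu = 1, which makes the rank-one part of the matrix
supply exactly the constant term of the Neumann equation. -/
theorem act_colVec (hz0 : z ≠ 0) (hz : z ≠ ∞) (hr : renewal A ψ δ z = 1) :
    act (regenMatrix A ψ δ) (colVec A δ z) = z⁻¹ • colVec A δ z := by
  rw [act_regenMatrix, pairing_colVec, hr, mul_one]
  have h1 : colVec A δ z = (δ * z) • (1 : S → ℝ≥0∞) + z • act A (colVec A δ z) := by
    conv_lhs => rw [colVec, neumann_eq]
    rw [colVec, map_smul, smul_add, smul_comm]
  conv_rhs => rw [h1, smul_add, smul_smul, smul_smul, ENNReal.inv_mul_cancel hz0 hz, one_smul,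
    mul_comm, mul_assoc, ENNReal.mul_inv_cancel hz0 hz, mul_one]

/-- Here the renewal equation enters through the total mass of the row vector, which is 1/(δz). -/
theorem act_rowVec (hz0 : z ≠ 0) (hz : z ≠ ∞) (hr : renewal A ψ δ z = 1) :
    act (transp (regenMatrix A ψ δ)) (rowVec A ψ z) = z⁻¹ • rowVec A ψ z := by
  rw [act_transp_regenMatrix, pairing_rowVec_one]
  have h0 : δ * pairing ψ (neumann z A 1) = z⁻¹ := by
    refine ENNReal.eq_inv_of_mul_eq_one_left ?_
    rw [← hr, renewal]
    ring
  conv_rhs => rw [rowVec, neumann_eq, smul_add, smul_smul, ENNReal.inv_mul_cancel hz0 hz, one_smul]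
  rw [h0, rowVec]

theorem eq_smul_colVec (h : IsRegenerative A ψ c) (hδ0 : δ ≠ 0) (hδ : δ ≠ ∞) (hz0 : z ≠ 0)
    (hz : z ≠ ∞) (hr : renewal A ψ δ z = 1) (v : S) {f : S → ℝ≥0∞} (hf : ∀ x, f x ≠ ∞)
    (hfe : act (regenMatrix A ψ δ) f = z⁻¹ • f) :
    pairing ψ f ≠ ∞ ∧ f = pairing ψ f • colVec A δ z := by
  -- An infinite ψ-mean would make the left side of the eigenvalue equation infinite at v.
  have hp : pairing ψ f ≠ ∞ := by
    intro ht
    have := congrFun hfe v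
    rw [act_regenMatrix, ht, ENNReal.mul_top hδ0, Pi.add_apply, Pi.smul_apply, Pi.smul_apply] at this
    simp only [Pi.one_apply, smul_eq_mul, mul_one, top_add] at this
    exact ENNReal.mul_ne_top (ENNReal.inv_ne_top.2 hz0) (hf v) this.symm
  refine ⟨hp, ?_⟩
  have h1 : f = (z * (δ * pairing ψ f)) • (1 : S → ℝ≥0∞) + z • act A f := by
    have : f = z • act (regenMatrix A ψ δ) f := by
      rw [hfe, smul_smul, ENNReal.mul_inv_cancel hz0 hz, one_smul]
    conv_lhs => rw [this, act_regenMatrix, smul_add, smul_smul]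
  have h2 : f ≤ (z * (δ * pairing ψ f) + z * (c * pairing ψ f)) • (1 : S → ℝ≥0∞) := by
    intro x
    conv_lhs => rw [h1]
    simp only [Pi.add_apply, Pi.smul_apply, Pi.one_apply, smul_eq_mul, mul_one]
    exact add_le_add_right (mul_le_mul_right (h.act_le f x) z) _
  have h3 := eq_smul_neumann h1 (ENNReal.mul_ne_top hz (ENNReal.mul_ne_top hδ hp))
    (ENNReal.add_ne_top.2 ⟨ENNReal.mul_ne_top hz (ENNReal.mul_ne_top hδ hp),
      ENNReal.mul_ne_top hz (ENNReal.mul_ne_top h.ne_top hp)⟩) h2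
    (h.neumann_ne_top hz (pairing_ne_top_of_renewal hz0 hδ0 hr))
  conv_lhs => rw [h3]
  rw [colVec, smul_smul]
  congr 1
  ring

theorem eq_smul_rowVec (h : IsRegenerative A ψ c) (hδ0 : δ ≠ 0) (hδ : δ ≠ ∞) (hz0 : z ≠ 0)
    (hz : z ≠ ∞) (hr : renewal A ψ δ z = 1) {f : S → ℝ≥0∞} (hf : ∀ x, f x ≠ ∞)
    (hfe : act (transp (regenMatrix A ψ δ)) f = z⁻¹ • f) :
    ∃ a : ℝ≥0∞, a ≠ ∞ ∧ f = a • rowVec A ψ z := by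
  have hp : pairing f 1 ≠ ∞ := by
    -- Finiteness of the total mass is read off at a point charged by ψ.
    obtain ⟨y, hy⟩ : ∃ y, ψ y ≠ 0 := by
      by_contra! h0
      have := h.tsum_eq_one
      simp [h0] at this
    intro ht
    have := congrFun hfe y
    rw [act_transp_regenMatrix, ht, ENNReal.mul_top hδ0, Pi.add_apply, Pi.smul_apply,
      Pi.smul_apply] at this
    simp only [smul_eq_mul, ENNReal.top_mul hy, top_add] at this
    exact ENNReal.mul_ne_top (ENNReal.inv_ne_top.2 hz0) (hf y) this.symm
  have h1 : f = (z * (δ * pairing f 1)) • ψ + z • act (transp A) f := by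
    have : f = z • act (transp (regenMatrix A ψ δ)) f := by
      rw [hfe, smul_smul, ENNReal.mul_inv_cancel hz0 hz, one_smul]
    conv_lhs => rw [this, act_transp_regenMatrix, smul_add, smul_smul]
  have h2 : f ≤ (z * (δ * pairing f 1) + z * (c * pairing f 1)) • ψ := by
    intro x
    conv_lhs => rw [h1]
    simp only [Pi.add_apply, Pi.smul_apply, smul_eq_mul]
    rw [add_mul, mul_assoc z (c * _)]
    exact add_le_add_right (mul_le_mul_right (h.act_transp_le f x) z) _
  exact ⟨_, ENNReal.mul_ne_top hz (ENNReal.mul_ne_top hδ hp),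
    eq_smul_neumann h1 (ENNReal.mul_ne_top hz (ENNReal.mul_ne_top hδ hp))
    (ENNReal.add_ne_top.2 ⟨ENNReal.mul_ne_top hz (ENNReal.mul_ne_top hδ hp),
      ENNReal.mul_ne_top hz (ENNReal.mul_ne_top h.ne_top hp)⟩) h2
    (h.rowVec_ne_top hz (pairing_ne_top_of_renewal hz0 hδ0 hr))⟩

end IsRegenerative

/-! ### Eigenvectors of real matrices -/

/-- The `[0, ∞]`-valued version of a real function. -/
def toE (u : S → ℝ) : S → ℝ≥0∞ := fun x => ENNReal.ofReal (u x)

/-- The `[0, ∞]`-valued version of a real matrix. -/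
def matE (Q : S → S → ℝ) : S → S → ℝ≥0∞ := fun x y => ENNReal.ofReal (Q x y)

/-- The bridge between real eigenvector equations, with convergence, and equations in [0, ∞]. -/
theorem hasSum_iff_tsum_ofReal {ι : Type*} {f : ι → ℝ} (hf : ∀ i, 0 ≤ f i) {a : ℝ} (ha : 0 ≤ a) :
    HasSum f a ↔ ∑' i, ENNReal.ofReal (f i) = ENNReal.ofReal a := by
  constructor
  · intro h
    rw [← ENNReal.ofReal_tsum_of_nonneg hf h.summable, h.tsum_eq]
  · intro h
    have hs : Summable f := by
      have : ∑' i, ENNReal.ofReal (f i) ≠ ∞ := by simp [h]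
      have h2 := ENNReal.summable_toReal this
      exact h2.congr fun i => by rw [ENNReal.toReal_ofReal (hf i)]
    rw [← ENNReal.ofReal_tsum_of_nonneg hf hs,
      ENNReal.ofReal_eq_ofReal_iff (tsum_nonneg hf) ha] at h
    exact h ▸ hs.hasSum

/-- `u` is, up to positive multiples, the only positive finite-valued eigenvector of the
operator `T` for the eigenvalue `lam`. -/
structure IsUniquePosEigenvector (T : Module.End ℝ≥0∞ (S → ℝ≥0∞)) (lam : ℝ) (u : S → ℝ) :
    Prop where
  pos : ∀ x, 0 < u x
  eq : T (toE u) = ENNReal.ofReal lam • toE u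
  unique : ∀ u' : S → ℝ, (∀ x, 0 < u' x) → T (toE u') = ENNReal.ofReal lam • toE u' →
    ∃ a : ℝ, 0 < a ∧ ∀ x, u' x = a * u x

theorem act_toE_eq_iff {Q : S → S → ℝ} (hQ : ∀ x y, 0 ≤ Q x y) {lam : ℝ} (hlam : 0 ≤ lam)
    {u : S → ℝ} (hu : ∀ x, 0 < u x) :
    act (matE Q) (toE u) = ENNReal.ofReal lam • toE u ↔
      ∀ x, HasSum (fun y => Q x y * u y) (lam * u x) := by
  rw [funext_iff]
  refine forall_congr' fun x => ?_
  rw [hasSum_iff_tsum_ofReal (fun y => mul_nonneg (hQ x y) (hu y).le)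
    (mul_nonneg hlam (hu x).le), ENNReal.ofReal_mul hlam]
  simp only [ENNReal.ofReal_mul (hQ x _)]
  rfl

theorem isUniquePosColEigenvector_iff {Q : S → S → ℝ} (hQ : ∀ x y, 0 ≤ Q x y) {lam : ℝ}
    (hlam : 0 ≤ lam) {u : S → ℝ} :
    IsUniquePosColEigenvector Q lam u ↔ IsUniquePosEigenvector (act (matE Q)) lam u := by
  constructor
  · rintro ⟨⟨hpos, heq⟩, huniq⟩
    exact ⟨hpos, (act_toE_eq_iff hQ hlam hpos).2 heq, fun u' hu' he =>
      huniq u' ⟨hu', (act_toE_eq_iff hQ hlam hu').1 he⟩⟩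
  · rintro ⟨hpos, heq, huniq⟩
    exact ⟨⟨hpos, (act_toE_eq_iff hQ hlam hpos).1 heq⟩, fun u' hu' =>
      huniq u' hu'.1 ((act_toE_eq_iff hQ hlam hu'.1).2 hu'.2)⟩

theorem isUniquePosRowEigenvector_iff {Q : S → S → ℝ} (hQ : ∀ x y, 0 ≤ Q x y) {lam : ℝ}
    (hlam : 0 ≤ lam) {u : S → ℝ} :
    IsUniquePosRowEigenvector Q lam u ↔ IsUniquePosEigenvector (act (transp (matE Q))) lam u := by
  have : IsUniquePosRowEigenvector Q lam u ↔ IsUniquePosColEigenvector (transp Q) lam u := by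
    simp only [IsUniquePosRowEigenvector, IsUniquePosColEigenvector, IsPosRowEigenvector,
      IsPosColEigenvector, transp, mul_comm]
  rw [this]
  exact isUniquePosColEigenvector_iff (fun x y => hQ y x) hlam

theorem toE_pos_mul {a : ℝ} (ha : 0 ≤ a) (u : S → ℝ) :
    toE (fun x => a * u x) = ENNReal.ofReal a • toE u :=
  funext fun _ => ENNReal.ofReal_mul ha

/-- If `T ^ m` has a unique positive eigenvector, then `T` has the same one. -/
theorem IsUniquePosEigenvector.root {T : Module.End ℝ≥0∞ (S → ℝ≥0∞)} {m : ℕ} (hm : m ≠ 0)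
    {lam : ℝ} (hlam : 0 < lam) {u : S → ℝ} (h : IsUniquePosEigenvector (T ^ m) lam u)
    (v : S) (hpos : ∀ x, T (toE u) x ≠ 0) (hfin : ∀ x, T (toE u) x ≠ ∞) :
    IsUniquePosEigenvector T (lam ^ (1 / (m : ℝ))) u := by
  have hmu : (lam ^ (1 / (m : ℝ))) ^ m = lam := by
    rw [one_div, Real.rpow_inv_natCast_pow hlam.le hm]
  have hpow : ∀ (b : ℝ≥0∞) (w : S → ℝ≥0∞), T w = b • w → ∀ n : ℕ, (T ^ n) w = b ^ n • w := by
    intro b w hw n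
    induction n with
    | zero => simp
    | succ n ih => rw [pow_succ', Module.End.mul_apply, ih, map_smul, hw, smul_smul, pow_succ]
  refine ⟨h.pos, ?_, fun u' hu' he => h.unique u' hu' ?_⟩
  · set w : S → ℝ := fun x => (T (toE u) x).toReal with hw
    have hwE : toE w = T (toE u) := funext fun x => ENNReal.ofReal_toReal (hfin x)
    -- T commutes with its power, so Tu solves the same eigenvalue equation as u.
    obtain ⟨a, ha, haw⟩ := h.unique w (fun x => ENNReal.toReal_pos (hpos x) (hfin x)) (by
      rw [hwE, ← Module.End.mul_apply, ← pow_succ, pow_succ', Module.End.mul_apply, h.eq, map_smul])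
    have hTa : T (toE u) = ENNReal.ofReal a • toE u := by
      rw [← hwE, ← toE_pos_mul ha.le]
      congr 1
      exact funext haw
    -- Comparing the two expressions for T^m u at one point gives a^m = lam.
    have h1 := congrFun (hpow _ _ hTa m) v
    rw [h.eq, Pi.smul_apply, Pi.smul_apply, smul_eq_mul, smul_eq_mul, ← ENNReal.ofReal_pow ha.le,
      toE, ← ENNReal.ofReal_mul hlam.le, ← ENNReal.ofReal_mul (pow_nonneg ha.le m),
      ENNReal.ofReal_eq_ofReal_iff (mul_nonneg hlam.le (h.pos v).le)
        (mul_nonneg (pow_nonneg ha.le m) (h.pos v).le)] at h1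
    have h2 : lam = a ^ m := mul_right_cancel₀ (h.pos v).ne' h1
    have h3 : lam ^ (1 / (m : ℝ)) = a := by
      rw [h2, one_div, Real.pow_rpow_inv_natCast ha.le hm]
    rw [h3, hTa]
  · rw [hpow _ _ he m, ← ENNReal.ofReal_pow (Real.rpow_nonneg hlam.le _), hmu]

/-! ### Powers -/

theorem matE_matPow_succ {Q : S → S → ℝ} (hQ : IsSubstochastic Q) (n : ℕ) (x y : S) :
    matE (matPow Q (n + 1)) x y = ∑' w, matE Q x w * matE (matPow Q n) w y := by
  have hn := hQ.pow n
  have hs : Summable fun w => Q x w * matPow Q n w y :=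
    Summable.of_nonneg_of_le (fun w => mul_nonneg (hQ.nonneg x w) (hn.nonneg w y))
      (fun w => mul_le_of_le_one_right (hQ.nonneg x w) (hn.le_one w y)) (hQ.summable x)
  simp only [matE, matPow]
  rw [ENNReal.ofReal_tsum_of_nonneg (fun w => mul_nonneg (hQ.nonneg x w) (hn.nonneg w y)) hs]
  exact tsum_congr fun w => ENNReal.ofReal_mul (hQ.nonneg x w)

theorem act_matPow_zero (Q : S → S → ℝ) : act (matE (matPow Q 0)) = 1 := by
  classical
  refine LinearMap.ext fun u => funext fun x => ?_
  rw [act_apply, tsum_eq_single x fun y hy => by simp [matE, matPow, hy.symm]]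
  simp [matE, matPow]

theorem transp_matPow_zero (Q : S → S → ℝ) : transp (matE (matPow Q 0)) = matE (matPow Q 0) := by
  funext x y
  rcases eq_or_ne x y with rfl | h
  · rfl
  · simp [transp, matE, matPow, h, h.symm]

theorem act_matPow {Q : S → S → ℝ} (hQ : IsSubstochastic Q) (n : ℕ) :
    act (matE (matPow Q n)) = act (matE Q) ^ n := by
  induction n with
  | zero => rw [pow_zero, act_matPow_zero]
  | succ n ih =>
    refine LinearMap.ext fun u => funext fun x => ?_
    rw [pow_succ', ← ih, Module.End.mul_apply]
    simp only [act_apply, matE_matPow_succ hQ, ← ENNReal.tsum_mul_left, ← ENNReal.tsum_mul_right]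
    rw [ENNReal.tsum_comm]
    simp only [mul_assoc]

theorem act_transp_matPow {Q : S → S → ℝ} (hQ : IsSubstochastic Q) (n : ℕ) :
    act (transp (matE (matPow Q n))) = act (transp (matE Q)) ^ n := by
  induction n with
  | zero => rw [pow_zero, transp_matPow_zero, act_matPow_zero]
  | succ n ih =>
    refine LinearMap.ext fun u => funext fun x => ?_
    rw [pow_succ, ← ih, Module.End.mul_apply]
    simp only [act_apply, transp, matE_matPow_succ hQ, ← ENNReal.tsum_mul_left,
      ← ENNReal.tsum_mul_right]
    rw [ENNReal.tsum_comm]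
    exact tsum_congr fun w => tsum_congr fun y => by ring

theorem matE_matPow_add {Q : S → S → ℝ} (hQ : IsSubstochastic Q) (k n : ℕ) (x y : S) :
    matE (matPow Q (k + n)) x y = ∑' w, matE (matPow Q k) x w * matE (matPow Q n) w y := by
  classical
  -- Column y of a power is the power applied to the indicator of y, so the entries inherit the
  -- semigroup law of operators.
  have h : ∀ n, (act (matE Q) ^ n) (Pi.single y 1) = fun x => matE (matPow Q n) x y := by
    intro n
    funext x
    rw [← act_matPow hQ]
    exact pairing_single (matE (matPow Q n) x) y
  rw [← congrFun (h (k + n)) x, pow_add, Module.End.mul_apply, h, ← act_matPow hQ, act_apply]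

end

/-! ### The law of the killed chain -/

/-- Up to time `k` the path has neither died nor regenerated. -/
def NoRegen (k : ℕ) (ω : ℕ → SplitState S) : Prop :=
  ω 0 ≠ none ∧ ∀ i, 1 ≤ i → i ≤ k → ∃ y, ω i = some (y, false)

/-- The path regenerates at time `k + 1` for the first time. -/
def RegenAt (k : ℕ) (ω : ℕ → SplitState S) : Prop :=
  NoRegen k ω ∧ ∃ y, ω (k + 1) = some (y, true)

theorem noRegen_succ {k : ℕ} {ω : ℕ → SplitState S} :
    NoRegen (k + 1) ω ↔ NoRegen k ω ∧ ∃ y, ω (k + 1) = some (y, false) := by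
  constructor
  · rintro ⟨h0, h⟩
    exact ⟨⟨h0, fun i h1 h2 => h i h1 (by omega)⟩, h _ (by omega) le_rfl⟩
  · rintro ⟨⟨h0, h⟩, h'⟩
    refine ⟨h0, fun i h1 h2 => ?_⟩
    rcases h2.lt_or_eq with h3 | rfl
    · exact h i h1 (by omega)
    · exact h'

theorem coe_lt_killTime_iff {n : ℕ} {ω : ℕ → SplitState S} :
    (n : ℕ∞) < killTime ω ↔ ∀ i ≤ n, ω i ≠ none := by
  constructor
  · intro h i hi hn
    have : killTime ω ≤ i := iInf₂_le i hn
    exact absurd (h.trans_le this) (by simpa using hi)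
  · intro h
    have : ((n + 1 : ℕ) : ℕ∞) ≤ killTime ω := le_iInf₂ fun i hi => by
      rw [Nat.cast_le]
      by_contra hlt
      exact h i (by omega) hi
    exact lt_of_lt_of_le (by exact_mod_cast n.lt_succ_self) this

theorem coe_lt_regenTime_iff {n : ℕ} {ω : ℕ → SplitState S} :
    (n : ℕ∞) < regenTime ω ↔ ∀ i, 1 ≤ i → i ≤ n → ¬ ∃ y, ω i = some (y, true) := by
  constructor
  · intro h i h1 hi hn
    have : regenTime ω ≤ i := iInf₂_le i ⟨h1, hn⟩
    exact absurd (h.trans_le this) (by simpa using hi)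
  · intro h
    have : ((n + 1 : ℕ) : ℕ∞) ≤ regenTime ω := le_iInf₂ fun i hi => by
      rw [Nat.cast_le]
      by_contra hlt
      exact h i hi.1 (by omega) hi.2
    exact lt_of_lt_of_le (by exact_mod_cast n.lt_succ_self) this

/-- The label at time 0 plays no role, because regenerations count only from time 1. -/
theorem noRegen_iff {k : ℕ} {ω : ℕ → SplitState S} :
    NoRegen k ω ↔ (k : ℕ∞) < regenTime ω ∧ (k : ℕ∞) < killTime ω := by
  rw [coe_lt_regenTime_iff, coe_lt_killTime_iff]
  constructor
  · rintro ⟨h0, h⟩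
    refine ⟨fun i h1 h2 ⟨y, hy⟩ => ?_, fun i hi => ?_⟩
    · obtain ⟨y', hy'⟩ := h i h1 h2
      have := hy.symm.trans hy'
      exact nomatch this
    · rcases Nat.eq_zero_or_pos i with rfl | h1
      · exact h0
      · obtain ⟨y', hy'⟩ := h i h1 hi
        rw [hy']
        exact fun h => nomatch h
  · rintro ⟨h1, h2⟩
    refine ⟨h2 0 (by omega), fun i hi hik => ?_⟩
    rcases hs : ω i with _ | ⟨y, b⟩
    · exact absurd hs (h2 i hik)
    · cases b
      · exact ⟨y, rfl⟩
      · exact absurd ⟨y, hs⟩ (h1 i hi hik)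

theorem regenAt_iff {k : ℕ} {ω : ℕ → SplitState S} :
    RegenAt k ω ↔ regenTime ω = (k + 1 : ℕ) ∧ regenTime ω < killTime ω := by
  constructor
  · rintro ⟨h, hy⟩
    have h1 := noRegen_iff.1 h
    have h2 : regenTime ω ≤ (k + 1 : ℕ) := iInf₂_le (k + 1) ⟨by omega, hy⟩
    have h3 : ((k + 1 : ℕ) : ℕ∞) ≤ regenTime ω := by
      have := Order.add_one_le_of_lt h1.1
      exact_mod_cast this
    have h4 : regenTime ω = (k + 1 : ℕ) := le_antisymm h2 h3
    refine ⟨h4, ?_⟩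
    rw [h4, coe_lt_killTime_iff]
    intro i hi
    rcases hi.lt_or_eq with h5 | rfl
    · exact coe_lt_killTime_iff.1 h1.2 i (by omega)
    · obtain ⟨y, hy⟩ := hy
      rw [hy]
      exact fun h => nomatch h
  · rintro ⟨h1, h2⟩
    have hk : (k : ℕ∞) < regenTime ω := by
      rw [h1]
      exact_mod_cast k.lt_succ_self
    refine ⟨noRegen_iff.2 ⟨hk, hk.trans h2⟩, ?_⟩
    by_contra hno
    have : ((k + 1 : ℕ) : ℕ∞) < regenTime ω := coe_lt_regenTime_iff.2 fun i hi hik => by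
      rcases hik.lt_or_eq with h5 | rfl
      · exact coe_lt_regenTime_iff.1 hk i hi (by omega)
      · exact hno
    exact absurd h1 this.ne'

-- The events of a first regeneration at k + 1 are disjoint, so at most one term survives; the
-- exponent is k + 1 because τ ≥ 1.
open Classical in
theorem expRegen_eq_tsum (θ : ℝ) (ω : ℕ → SplitState S) :
    expRegen θ ω = ∑' k : ℕ, ENNReal.ofReal (Real.exp θ) ^ (k + 1) *
      (if RegenAt k ω then 1 else 0) := by
  have hexp : ∀ n : ℕ, ENNReal.ofReal (Real.exp (θ * n)) = ENNReal.ofReal (Real.exp θ) ^ n := by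
    intro n
    rw [mul_comm, Real.exp_nat_mul, ENNReal.ofReal_pow (Real.exp_pos θ).le]
  rw [expRegen]
  split_ifs with h
  · have h0 : regenTime ω ≠ ⊤ := h.ne_top
    have h1 : regenTime ω ≠ 0 := by
      have : ((0 : ℕ) : ℕ∞) < regenTime ω := coe_lt_regenTime_iff.2 fun i h1 h2 => by omega
      exact this.ne'
    obtain ⟨n, hn⟩ := ENat.ne_top_iff_exists.1 h0
    obtain ⟨k, rfl⟩ : ∃ k, n = k + 1 := Nat.exists_eq_succ_of_ne_zero (by
      rintro rfl
      exact h1 hn.symm)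
    rw [tsum_eq_single k, if_pos (regenAt_iff.2 ⟨hn.symm, h⟩), ← hn, ENat.toNat_natCast, hexp, mul_one]
    intro j hj
    rw [if_neg, mul_zero]
    intro hR
    have := (regenAt_iff.1 hR).1
    rw [← hn, Nat.cast_inj] at this
    omega
  · refine (ENNReal.tsum_eq_zero.2 fun k => ?_).symm
    rw [if_neg fun hR => h (regenAt_iff.1 hR).2, mul_zero]

open Classical in
theorem expOccupation_eq_tsum (θ : ℝ) (y : S) (ω : ℕ → SplitState S) :
    expOccupation θ y ω = ∑' k : ℕ, ENNReal.ofReal (Real.exp θ) ^ k *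
      (if NoRegen k ω ∧ ∃ b, ω k = some (y, b) then 1 else 0) := by
  refine tsum_congr fun k => ?_
  have : ((k : ℕ∞) < regenTime ω ∧ (∃ b, ω k = some (y, b)) ∧ (k : ℕ∞) < killTime ω) ↔
      NoRegen k ω ∧ ∃ b, ω k = some (y, b) := by
    rw [noRegen_iff]
    tauto
  simp only [this]
  rw [mul_comm θ, Real.exp_nat_mul, ENNReal.ofReal_pow (Real.exp_pos θ).le, mul_ite, mul_one,
    mul_zero]

/-- The non-regenerative part of the transitions. -/
def nonRegen (Q : S → S → ℝ) (v : S) (c₁ : ℝ) : S → S → ℝ≥0∞ :=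
  fun x y => stepWeight Q v c₁ x (some (y, false))

theorem tsum_option_eq {α : Type*} (g : Option α → ℝ≥0∞) :
    ∑' s, g s = g none + ∑' p, g (some p) := by
  rw [← (Equiv.optionEquivSumPUnit.{0} α).symm.tsum_eq,
    ENNReal.summable.tsum_sum ENNReal.summable, add_comm]
  simp

/-! ### Path functionals as Neumann series -/

section Chain

variable {Q : S → S → ℝ} (hQ : IsSubstochastic Q) {v : S} {c₁ c₂ : ℝ}
  (h : RowsComparable Q v c₁ c₂)

theorem lintegral_stepKernel [Countable S] (x : S) (b : Bool) (f : SplitState S → ℝ≥0∞)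
    (hf : f none = 0) :
    ∫⁻ s, f s ∂(stepKernel hQ h (some (x, b))) =
      (∑' y, nonRegen Q v c₁ x y * f (some (y, false))) +
        ∑' y, ENNReal.ofReal (delta Q v c₁ * psi Q v y) * f (some (y, true)) := by
  have h0 : stepKernel hQ h (some (x, b)) = (stepLaw hQ h (some (x, b))).toMeasure := rfl
  have h1 : ∀ s, f s * (stepLaw hQ h (some (x, b))).toMeasure {s} = f s * stepWeight Q v c₁ x s :=
    fun s => by
      rw [PMF.toMeasure_apply_singleton _ _ (measurableSet_singleton s)]
      rfl
  rw [h0, lintegral_countable', tsum_congr h1]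
  refine (tsum_option_eq fun s : Option (S × Bool) => f s * stepWeight Q v c₁ x s).trans ?_
  have h2 : f (none : Option (S × Bool)) * stepWeight Q v c₁ x none = 0 :=
    (congrArg (· * stepWeight Q v c₁ x none) hf).trans (zero_mul _)
  rw [h2, zero_add, ENNReal.tsum_prod', ← ENNReal.tsum_add]
  refine tsum_congr fun y => ?_
  rw [tsum_fintype, Fintype.sum_bool, add_comm]
  exact congrArg₂ (· + ·) (mul_comm _ _) (mul_comm _ _)

instance [Countable S] (x : S) : IsProbabilityMeasure (pathLaw hQ h x) := by
  have : IsProbabilityMeasure (Measure.dirac (α := SplitState S) (some (x, false))) :=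
    Measure.dirac.isProbabilityMeasure
  exact inferInstanceAs (IsProbabilityMeasure (Kernel.trajMeasure (X := fun _ => SplitState S) _ _))

theorem map_zero_pathLaw [Countable S] (x : S) :
    (pathLaw hQ h x).map (fun ω => ω 0) = Measure.dirac (α := SplitState S) (some (x, false)) := by
  have h0 : (fun ω : ℕ → SplitState S => ω 0) =
      (MeasurableEquiv.piUnique fun _ : Finset.Iic 0 => SplitState S) ∘
        Preorder.frestrictLe (π := fun _ : ℕ => SplitState S) 0 := rfl
  rw [h0, ← Measure.map_map (by fun_prop) (by fun_prop), pathLaw, Kernel.trajMeasure,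
    Measure.map_comp _ _ (by fun_prop), Kernel.traj_map_frestrictLe, Kernel.partialTraj_self,
    Measure.id_comp]
  exact MeasurableEquiv.map_map_symm _

/-- The Markov property: the joint law of the path up to k and the next state is a composition
product with the transition kernel. -/
theorem lintegral_pathLaw_succ [Countable S] (x : S) (k : ℕ)
    (f : ((i : Finset.Iic k) → SplitState S) → ℝ≥0∞) (hf : Measurable f)
    (g : SplitState S → ℝ≥0∞) :
    ∫⁻ ω, f (Preorder.frestrictLe k ω) * g (ω (k + 1)) ∂(pathLaw hQ h x) =
      ∫⁻ ω, f (Preorder.frestrictLe k ω) * ∫⁻ s, g s ∂(stepKernel hQ h (ω k))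
        ∂(pathLaw hQ h x) := by
  have : IsProbabilityMeasure (Measure.dirac (α := SplitState S) (some (x, false))) :=
    Measure.dirac.isProbabilityMeasure
  have key := Kernel.map_frestrictLe_trajMeasure_compProd_eq_map_trajMeasure
    (X := fun _ => SplitState S) (μ₀ := Measure.dirac (α := SplitState S) (some (x, false)))
    (κ := fun n => (stepKernel hQ h).comap
      (fun path : (i : Finset.Iic n) → SplitState S => path ⟨n, Finset.mem_Iic.2 le_rfl⟩)
      (measurable_pi_apply _)) (a := k)
  have hg : Measurable g := .of_discrete
  have hF : Measurable fun p : ((i : Finset.Iic k) → SplitState S) × SplitState S =>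
      f p.1 * g p.2 := by fun_prop
  have h1 := lintegral_map (μ := pathLaw hQ h x) hF
    (g := fun ω => (Preorder.frestrictLe (π := fun _ : ℕ => SplitState S) k ω, ω (k + 1)))
    (by fun_prop)
  refine h1.symm.trans ?_
  unfold pathLaw
  rw [← key, Measure.lintegral_compProd hF, lintegral_map (by fun_prop) (by fun_prop)]
  refine lintegral_congr fun ω => ?_
  exact lintegral_const_mul (μ := stepKernel hQ h (ω k))
    (f (Preorder.frestrictLe (π := fun _ : ℕ => SplitState S) k ω)) hg

open Classical in
/-- The event `NoRegen k` depends only on the path up to time `k`. -/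
theorem exists_noRegen_frestrictLe [Countable S] (k : ℕ) :
    ∃ f : ((i : Finset.Iic k) → SplitState S) → ℝ≥0∞, Measurable f ∧
      ∀ ω : ℕ → SplitState S, f (Preorder.frestrictLe k ω) = if NoRegen k ω then 1 else 0 := by
  refine ⟨fun p => if p ⟨0, by simp⟩ ≠ none ∧ ∀ i : Finset.Iic k, 1 ≤ i.1 →
    ∃ y, p i = some (y, false) then 1 else 0, .of_discrete, fun ω => ?_⟩
  refine if_congr ⟨fun h => ⟨h.1, fun i h1 h2 => h.2 ⟨i, Finset.mem_Iic.2 h2⟩ h1⟩,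
    fun h => ⟨h.1, fun i h1 => h.2 i.1 h1 (Finset.mem_Iic.1 i.2)⟩⟩ rfl rfl

open Classical in
theorem lintegral_noRegen_succ [Countable S] (x : S) (k : ℕ) (g : SplitState S → ℝ≥0∞) :
    ∫⁻ ω, (if NoRegen k ω then 1 else 0) * g (ω (k + 1)) ∂(pathLaw hQ h x) =
      ∫⁻ ω, (if NoRegen k ω then 1 else 0) * ∫⁻ s, g s ∂(stepKernel hQ h (ω k))
        ∂(pathLaw hQ h x) := by
  obtain ⟨f, hf, hfω⟩ := exists_noRegen_frestrictLe (S := S) k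
  simp only [← hfω]
  exact lintegral_pathLaw_succ hQ h x k f hf g

open Classical in
/-- The law of the position at time `k` on the event that the chain has not regenerated yet. -/
theorem lintegral_noRegen [Countable S] (x : S) (k : ℕ) (f : S → ℝ≥0∞) (g : SplitState S → ℝ≥0∞)
    (hg : ∀ y b, g (some (y, b)) = f y) :
    ∫⁻ ω, (if NoRegen k ω then 1 else 0) * g (ω k) ∂(pathLaw hQ h x) =
      (act (nonRegen Q v c₁) ^ k) f x := by
  induction k generalizing f g with
  | zero =>
    have hG : Measurable fun s : SplitState S => (if s ≠ none then 1 else 0) * g s := .of_discrete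
    have h1 := lintegral_map (μ := pathLaw hQ h x) hG (g := fun ω => ω 0) (by fun_prop)
    rw [map_zero_pathLaw] at h1
    have h3 := h1.symm.trans (lintegral_dirac' (α := SplitState S) (some (x, false)) hG)
    have h2 : ∀ ω : ℕ → SplitState S, NoRegen 0 ω ↔ ω 0 ≠ none := fun ω =>
      ⟨fun h => h.1, fun h => ⟨h, fun i h1 h2 => by omega⟩⟩
    simp only [h2]
    refine h3.trans ?_
    rw [if_pos (by exact fun h => nomatch h), one_mul, pow_zero]
    exact hg x false
  | succ k ih =>
    -- The requirement on step k + 1 is absorbed into the test function; integrating that step out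
    -- then replaces f by Af at time k.
    set g' : SplitState S → ℝ≥0∞ := fun s => if ∃ y, s = some (y, false) then g s else 0 with hg'
    have h1 : ∀ ω : ℕ → SplitState S, (if NoRegen (k + 1) ω then 1 else 0) * g (ω (k + 1)) =
        (if NoRegen k ω then 1 else 0) * g' (ω (k + 1)) := fun ω => by
      simp only [hg', noRegen_succ]
      by_cases hk : NoRegen k ω <;> by_cases hy : ∃ y, ω (k + 1) = some (y, false) <;>
        simp [hk, hy]
    simp only [h1]
    rw [lintegral_noRegen_succ, pow_succ, Module.End.mul_apply]
    refine ih _ (fun s => ∫⁻ t, g' t ∂(stepKernel hQ h s)) fun y b => ?_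
    rw [lintegral_stepKernel]
    · have h2 : ∀ y, g' (some (y, false)) = f y := fun y => by
        rw [← hg y false]
        exact if_pos ⟨y, rfl⟩
      have h3 : ∀ y, g' (some (y, true)) = 0 := fun y => if_neg fun ⟨_, h⟩ => nomatch h
      simp only [h2, h3, mul_zero, tsum_zero, add_zero]
      rfl
    · exact if_neg fun ⟨_, h⟩ => nomatch h

-- From every living state the next step regenerates with the same probability, so that factor
-- splits off from the survival term.
open Classical in
theorem lintegral_regenAt [Countable S] (x : S) (k : ℕ) :
    ∫⁻ ω, (if RegenAt k ω then 1 else 0) ∂(pathLaw hQ h x) =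
      (∑' y, ENNReal.ofReal (delta Q v c₁ * psi Q v y)) * (act (nonRegen Q v c₁) ^ k) 1 x := by
  set D := ∑' y, ENNReal.ofReal (delta Q v c₁ * psi Q v y) with hD
  set g : SplitState S → ℝ≥0∞ := fun s => if ∃ y, s = some (y, true) then 1 else 0 with hg
  have h1 : ∀ ω : ℕ → SplitState S, (if RegenAt k ω then (1 : ℝ≥0∞) else 0) =
      (if NoRegen k ω then 1 else 0) * g (ω (k + 1)) := fun ω => by
    simp only [hg, RegenAt]
    by_cases hk : NoRegen k ω <;> by_cases hy : ∃ y, ω (k + 1) = some (y, true) <;> simp [hk, hy]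
  simp only [h1]
  rw [lintegral_noRegen_succ, lintegral_noRegen hQ h x k (D • 1)
    (fun s => ∫⁻ t, g t ∂(stepKernel hQ h s)) fun y b => ?_, map_smul]
  · rfl
  · rw [lintegral_stepKernel]
    · have h2 : ∀ y, g (some (y, false)) = 0 := fun y => if_neg fun ⟨_, h⟩ => nomatch h
      have h3 : ∀ y, g (some (y, true)) = 1 := fun y => if_pos ⟨y, rfl⟩
      simp only [h2, h3, mul_zero, tsum_zero, zero_add, mul_one]
      simp [hD]
    · exact if_neg fun ⟨_, h⟩ => nomatch h

theorem measurableSet_noRegen [Countable S] (k : ℕ) :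
    MeasurableSet {ω : ℕ → SplitState S | NoRegen k ω} := by
  classical
  obtain ⟨f, hf, hfω⟩ := exists_noRegen_frestrictLe (S := S) k
  have h1 : {ω : ℕ → SplitState S | NoRegen k ω} =
      (fun ω => f (Preorder.frestrictLe (π := fun _ : ℕ => SplitState S) k ω)) ⁻¹' {1} := by
    ext ω
    simp [hfω]
  rw [h1]
  have h2 : Measurable fun ω => f (Preorder.frestrictLe (π := fun _ : ℕ => SplitState S) k ω) := by
    fun_prop
  exact h2 (measurableSet_singleton 1)

theorem measurableSet_apply_mem (k : ℕ) (s : Set (SplitState S)) :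
    MeasurableSet {ω : ℕ → SplitState S | ω k ∈ s} :=
  measurable_pi_apply k (MeasurableSet.of_discrete (s := s))

theorem uStar_eq [Countable S] (θ : ℝ) :
    uStar hQ h θ = colVec (nonRegen Q v c₁) (∑' y, ENNReal.ofReal (delta Q v c₁ * psi Q v y))
      (ENNReal.ofReal (Real.exp θ)) := by
  classical
  funext x
  have hm : ∀ k : ℕ, Measurable fun ω : ℕ → SplitState S => if RegenAt k ω then (1 : ℝ≥0∞) else 0 :=
    fun k => Measurable.ite ((measurableSet_noRegen k).inter
      (measurableSet_apply_mem (k + 1) {s : SplitState S | ∃ y, s = some (y, true)}))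
      measurable_const measurable_const
  rw [uStar, expect]
  simp only [expRegen_eq_tsum]
  rw [lintegral_tsum fun k => ((hm k).const_mul _).aemeasurable, colVec, Pi.smul_apply, smul_eq_mul,
    neumann, ← ENNReal.tsum_mul_left]
  refine tsum_congr fun k => ?_
  rw [lintegral_const_mul _ (hm k), lintegral_regenAt]
  ring

theorem etaStar_eq [Countable S] (θ : ℝ) :
    etaStar hQ h θ = rowVec (nonRegen Q v c₁) (toE (psi Q v)) (ENNReal.ofReal (Real.exp θ)) := by
  classical
  funext y
  set z := ENNReal.ofReal (Real.exp θ)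
  have hm : ∀ k : ℕ, Measurable fun ω : ℕ → SplitState S =>
      if NoRegen k ω ∧ ∃ b, ω k = some (y, b) then (1 : ℝ≥0∞) else 0 :=
    fun k => Measurable.ite ((measurableSet_noRegen k).inter
      (measurableSet_apply_mem k {s : SplitState S | ∃ b, s = some (y, b)}))
      measurable_const measurable_const
  have h1 : ∀ x, expect hQ h x (expOccupation θ y) =
      neumann z (nonRegen Q v c₁) (Pi.single y 1) x := by
    intro x
    rw [expect]
    simp only [expOccupation_eq_tsum]
    rw [lintegral_tsum fun k => ((hm k).const_mul _).aemeasurable, neumann]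
    refine tsum_congr fun k => ?_
    rw [lintegral_const_mul _ (hm k), ← lintegral_noRegen hQ h x k (Pi.single y 1)
      (fun s => if ∃ b, s = some (y, b) then 1 else 0) fun w b => ?_]
    · congr 1
      refine lintegral_congr fun ω => ?_
      by_cases hk : NoRegen k ω <;> by_cases hy : ∃ b, ω k = some (y, b) <;> simp [hk, hy]
    · rcases eq_or_ne w y with rfl | hw
      · rw [Pi.single_eq_same]
        exact if_pos ⟨b, rfl⟩
      · rw [Pi.single_eq_of_ne hw]
        refine if_neg fun ⟨b', hb⟩ => hw ?_
        exact (Prod.mk.inj (Option.some.inj hb)).1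
  have h2 : etaStar hQ h θ y = pairing (toE (psi Q v)) (neumann z (nonRegen Q v c₁) (Pi.single y 1)) :=
    tsum_congr fun x => by rw [h1 x]; rfl
  rw [h2, ← pairing_neumann_transp, pairing_comm, pairing_single, rowVec]

theorem expectPsi_expRegen_eq [Countable S] (θ : ℝ) :
    expectPsi hQ h (expRegen θ) = renewal (nonRegen Q v c₁) (toE (psi Q v))
      (∑' y, ENNReal.ofReal (delta Q v c₁ * psi Q v y)) (ENNReal.ofReal (Real.exp θ)) := by
  rw [← pairing_colVec, ← uStar_eq hQ h]
  rfl

end Chain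

/-! ### Geometric convergence of the powers -/

theorem IsPosRowEigenvector.matPow {B : S → S → ℝ} (hB : IsSubstochastic B) {μ : ℝ} (hμ : 0 ≤ μ)
    {η : S → ℝ} (h : IsPosRowEigenvector B μ η) (n : ℕ) :
    IsPosRowEigenvector (matPow B n) (μ ^ n) η := by
  refine ⟨h.1, ?_⟩
  have h1 : act (transp (matE B)) (toE η) = ENNReal.ofReal μ • toE η :=
    (act_toE_eq_iff (Q := transp B) (fun x y => hB.nonneg y x) hμ h.1).2 fun x => by
      simpa only [transp, mul_comm] using h.2 x
  have h2 : act (transp (matE (PerronFrobenius.matPow B n))) (toE η) =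
      ENNReal.ofReal (μ ^ n) • toE η := by
    rw [act_transp_matPow hB]
    induction n with
    | zero => simp
    | succ n ih =>
      rw [pow_succ', Module.End.mul_apply, ih, map_smul, h1, smul_smul, pow_succ,
        ENNReal.ofReal_mul (pow_nonneg hμ n)]
  have h3 := (act_toE_eq_iff (Q := transp (PerronFrobenius.matPow B n))
    (fun x y => (hB.pow n).nonneg y x) (pow_nonneg hμ n) h.1).1 h2
  intro y
  simpa only [transp, mul_comm] using h3 y

theorem hasSum_matPow_add {B : S → S → ℝ} (hB : IsSubstochastic B) (k n : ℕ) (x y : S) :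
    HasSum (fun w => matPow B k x w * matPow B n w y) (matPow B (k + n) x y) := by
  rw [hasSum_iff_tsum_ofReal (fun w => mul_nonneg ((hB.pow k).nonneg x w) ((hB.pow n).nonneg w y))
    ((hB.pow _).nonneg x y)]
  simp only [ENNReal.ofReal_mul ((hB.pow k).nonneg x _)]
  exact (matE_matPow_add hB k n x y).symm

/-- A function orthogonal to `η` is contracted by a matrix which dominates a multiple of
`u ⊗ η`. -/
theorem abs_le_of_hasSum_of_minorized {Q : S → S → ℝ} {u η w w' : S → ℝ} {lam s ε K : ℝ}
    (hQu : ∀ x, HasSum (fun y => Q x y * u y) (lam * u x))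
    (hs : HasSum (fun y => u y * η y) s) (hmin : ∀ x y, ε * u x * η y ≤ Q x y)
    (hw0 : HasSum (fun y => η y * w y) 0) (hw : ∀ x, |w x| ≤ K * u x)
    (hw' : ∀ x, HasSum (fun y => Q x y * w y) (w' x)) (x : S) :
    |w' x| ≤ (lam - ε * s) * K * u x := by
  -- As w is orthogonal to η, the rank-one part may be removed; the remaining matrix is nonnegative
  -- and sends u to (lam - εs)u.
  have h1 : HasSum (fun y => (Q x y - ε * u x * η y) * w y) (w' x) := by
    have := (hw' x).sub (hw0.mul_left (ε * u x))
    simp only [mul_zero, sub_zero] at this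
    refine this.congr_fun fun y => ?_
    ring
  have h2 : HasSum (fun y => (Q x y - ε * u x * η y) * (K * u y))
      ((lam - ε * s) * K * u x) := by
    have := ((hQu x).mul_left K).sub (hs.mul_left (ε * u x * K))
    rw [show (lam - ε * s) * K * u x = K * (lam * u x) - ε * u x * K * s by ring]
    refine this.congr_fun fun y => ?_
    ring
  refine h1.norm_le_of_bounded h2 fun y => ?_
  rw [Real.norm_eq_abs, abs_mul, abs_of_nonneg (sub_nonneg.2 (hmin x y))]
  exact mul_le_mul_of_nonneg_left (hw y) (sub_nonneg.2 (hmin x y))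

theorem tendsto_matPow_div_pow {B : S → S → ℝ} (hB : IsSubstochastic B) {m : ℕ} (hm : 0 < m)
    {μ : ℝ} (hμ : 0 < μ) {u η : S → ℝ} (hη : IsPosRowEigenvector B μ η)
    (hu : IsPosColEigenvector (matPow B m) (μ ^ m) u) {s ε ι : ℝ}
    (hs : HasSum (fun y => u y * η y) s) (hs0 : 0 < s) (hε : 0 < ε)
    (hmin : ∀ x y, ε * u x * η y ≤ matPow B m x y) (hι : 0 < ι) (hιu : ∀ x, ι ≤ u x) (x y : S) :
    Tendsto (fun n : ℕ => matPow B n x y / μ ^ n) atTop (𝓝 (u x * η y / s)) := by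
  set t := η y / s with ht
  have ht0 : 0 < t := div_pos (hη.1 y) hs0
  -- The error in column y. The value t = η(y)/s is the one making it orthogonal to η for every n.
  set w : ℕ → S → ℝ := fun n x => matPow B n x y - t * μ ^ n * u x with hw
  set r := μ ^ m - ε * s with hr
  have hw0 : ∀ n, HasSum (fun x => η x * w n x) 0 := by
    intro n
    have h1 := ((hη.matPow hB hμ.le n).2 y).sub (hs.mul_left (t * μ ^ n))
    have h2 : μ ^ n * η y - t * μ ^ n * s = 0 := by
      rw [ht]
      field_simp
      ring
    rw [h2] at h1
    refine h1.congr_fun fun x => ?_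
    simp only [hw]
    ring
  have hstep : ∀ n x, HasSum (fun a => matPow B m x a * w n a) (w (m + n) x) := by
    intro n x
    have h1 := (hasSum_matPow_add hB m n x y).sub ((hu.2 x).mul_left (t * μ ^ n))
    have h2 : matPow B (m + n) x y - t * μ ^ n * (μ ^ m * u x) = w (m + n) x := by
      simp only [hw, pow_add]
      ring
    rw [h2] at h1
    refine h1.congr_fun fun a => ?_
    simp only [hw]
    ring
  -- K bounds the error relative to u for all residues j < m at once: entries are at most 1 ≤ u/ι,
  -- and each μ^j is at most the sum.
  set K := 1 / ι + t * ∑ i ∈ Finset.range m, μ ^ i with hK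
  have hbase : ∀ j < m, ∀ x, |w j x| ≤ K * u x := by
    intro j hj x
    have hux : 0 < u x := hι.trans_le (hιu x)
    have h1 : matPow B j x y ≤ 1 / ι * u x := by
      refine ((hB.pow j).le_one x y).trans ?_
      rw [one_div, inv_mul_eq_div, one_le_div hι]
      exact hιu x
    have h2 : μ ^ j ≤ ∑ i ∈ Finset.range m, μ ^ i :=
      Finset.single_le_sum (f := fun i => μ ^ i) (fun i _ => pow_nonneg hμ.le i)
        (Finset.mem_range.2 hj)
    have h3 : t * μ ^ j * u x ≤ t * (∑ i ∈ Finset.range m, μ ^ i) * u x := by gcongr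
    have h4 : 0 ≤ t * μ ^ j * u x := by positivity
    rw [abs_le, hK, add_mul]
    have h5 := (hB.pow j).nonneg x y
    have h6 : 0 ≤ 1 / ι * u x := by positivity
    constructor <;> simp only [hw] <;> linarith
  have hr0 : 0 ≤ r := by
    have h1 := (hu.2 x).sub (hs.mul_left (ε * u x))
    have h2 : 0 ≤ μ ^ m * u x - ε * u x * s := h1.nonneg fun a => by
      have := mul_le_mul_of_nonneg_right (hmin x a) (hι.le.trans (hιu a))
      linarith
    have h3 : 0 ≤ r * u x := by
      rw [hr]
      linarith
    exact nonneg_of_mul_nonneg_left h3 (hι.trans_le (hιu x))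
  have hiter : ∀ q : ℕ, ∀ j < m, ∀ x, |w (m * q + j) x| ≤ r ^ q * K * u x := by
    intro q
    induction q with
    | zero => simpa using hbase
    | succ q ih =>
      intro j hj x
      have := abs_le_of_hasSum_of_minorized hu.2 hs hmin (hw0 (m * q + j)) (ih j hj)
        (hstep (m * q + j)) x
      rw [show m * (q + 1) + j = m + (m * q + j) by ring, pow_succ']
      calc _ ≤ _ := this
        _ = _ := by rw [hr]; ring
  set M := ∑ i ∈ Finset.range m, (μ ^ i)⁻¹ with hM
  have hKu : 0 ≤ K * u x := (abs_nonneg _).trans (hbase 0 hm x)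
  -- Write n = mq + j with j < m: the q blocks contract, and M absorbs the factor μ^(-j).
  have hbound : ∀ n : ℕ, |matPow B n x y / μ ^ n - u x * η y / s| ≤
      (r / μ ^ m) ^ (n / m) * (K * u x * M) := by
    intro n
    have hn : m * (n / m) + n % m = n := Nat.div_add_mod n m
    have hj := Nat.mod_lt n hm
    have h1 : matPow B n x y / μ ^ n - u x * η y / s = w n x / μ ^ n := by
      simp only [hw, ht]
      field_simp
    have h2 : |w n x| ≤ r ^ (n / m) * K * u x := by
      have := hiter (n / m) (n % m) hj x
      rwa [hn] at this
    have h3 : (μ ^ (n % m))⁻¹ ≤ M :=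
      Finset.single_le_sum (f := fun i => (μ ^ i)⁻¹) (fun i _ => by positivity)
        (Finset.mem_range.2 hj)
    have h4 : μ ^ n = (μ ^ m) ^ (n / m) * μ ^ (n % m) := by
      rw [← pow_mul, ← pow_add, hn]
    rw [h1, abs_div, abs_of_pos (pow_pos hμ n)]
    calc |w n x| / μ ^ n ≤ r ^ (n / m) * K * u x / μ ^ n := by gcongr
      _ = (r / μ ^ m) ^ (n / m) * (K * u x * (μ ^ (n % m))⁻¹) := by
        rw [h4, div_pow]
        field_simp
      _ ≤ _ := by gcongr
  have hρ0 : 0 ≤ r / μ ^ m := by positivity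
  have hρ1 : r / μ ^ m < 1 := by
    rw [div_lt_one (by positivity), hr]
    linarith [mul_pos hε hs0]
  have hlim : Tendsto (fun n : ℕ => (r / μ ^ m) ^ (n / m) * (K * u x * M)) atTop (𝓝 0) := by
    have := ((tendsto_pow_atTop_nhds_zero_of_lt_one hρ0 hρ1).comp
      (Nat.tendsto_div_const_atTop hm.ne')).mul_const (K * u x * M)
    simpa using this
  rw [tendsto_iff_norm_sub_tendsto_zero]
  exact squeeze_zero (fun _ => norm_nonneg _) hbound hlim

/-! ### Positivity -/

theorem matPow_add_pos {B : S → S → ℝ} (hB : IsSubstochastic B) {k n : ℕ} {x w y : S}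
    (h1 : 0 < matPow B k x w) (h2 : 0 < matPow B n w y) : 0 < matPow B (k + n) x y :=
  (mul_pos h1 h2).trans_le <| le_hasSum (hasSum_matPow_add hB k n x y) w fun a _ =>
    mul_nonneg ((hB.pow k).nonneg x a) ((hB.pow n).nonneg a y)

theorem exists_pos_of_matPow_add_pos {B : S → S → ℝ} (hB : IsSubstochastic B) {k n : ℕ} {x y : S}
    (h : 0 < matPow B (k + n) x y) : ∃ w, 0 < matPow B k x w ∧ 0 < matPow B n w y := by
  by_contra! hno
  have h1 : ∀ w, matPow B k x w * matPow B n w y = 0 := fun w => by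
    rcases ((hB.pow k).nonneg x w).eq_or_lt with h0 | h0
    · rw [← h0, zero_mul]
    · rw [le_antisymm (hno w h0) ((hB.pow n).nonneg w y), mul_zero]
  have h2 := hasSum_matPow_add hB k n x y
  simp only [h1] at h2
  exact h.ne (hasSum_zero.unique h2)

theorem matPow_one {B : S → S → ℝ} (x y : S) : matPow B 1 x y = B x y := by
  classical
  simp only [matPow]
  rw [tsum_eq_single y fun w hw => by simp [hw]]
  simp

/-- Repeating a loop at y gives a loop of length at least m, and its last m steps show that column y
of the power is not zero. The upper comparison carries this to row v, the lower one from v to every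
row. -/
theorem IsIrred.matPow_pos {B : S → S → ℝ} (hB : IsSubstochastic B) (hirr : IsIrred B) {m : ℕ}
    {v : S} {c₁ c₂ : ℝ} (h : RowsComparable (matPow B m) v c₁ c₂) (x y : S) :
    0 < matPow B m x y := by
  obtain ⟨n, hn, hny⟩ := hirr y y
  have h1 : ∀ j, 0 < matPow B (j * n) y y := by
    intro j
    induction j with
    | zero => simp [matPow]
    | succ j ih =>
      rw [add_mul, one_mul]
      exact matPow_add_pos hB ih hny
  have h2 := h1 m
  rw [← Nat.sub_add_cancel (Nat.le_mul_of_pos_right m hn)] at h2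
  obtain ⟨w, -, hw⟩ := exists_pos_of_matPow_add_pos hB h2
  have h3 : matPow B m v y ≠ 0 := fun h0 => by
    have := h.upper w y
    rw [h0, mul_zero] at this
    exact this.not_gt hw
  have h4 : 0 < matPow B m v y := lt_of_le_of_ne ((hB.pow m).nonneg v y) h3.symm
  exact (mul_pos h.pos h4).trans_le (h.lower x y)

/-! ### The regenerative decomposition of a matrix with comparable rows -/

section Decomposition

variable {Q : S → S → ℝ} (hQ : IsSubstochastic Q) {v : S} {c₁ c₂ : ℝ}
  (h : RowsComparable Q v c₁ c₂) (hpos : ∀ x y, 0 < Q x y)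
include hQ hpos

theorem tsum_row_pos : 0 < ∑' w, Q v w :=
  (hQ.summable v).tsum_pos (fun w => hQ.nonneg v w) v (hpos v v)

theorem hasSum_psi : HasSum (psi Q v) 1 := by
  have := (hQ.summable v).hasSum.div_const (∑' w, Q v w)
  rwa [div_self (tsum_row_pos hQ hpos).ne'] at this

theorem psi_pos (y : S) : 0 < psi Q v y := div_pos (hpos v y) (tsum_row_pos hQ hpos)

include h

theorem delta_pos : 0 < delta Q v c₁ := mul_pos h.pos (tsum_row_pos hQ hpos)

theorem tsum_delta_mul_psi :
    ∑' y, ENNReal.ofReal (delta Q v c₁ * psi Q v y) = ENNReal.ofReal (delta Q v c₁) := by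
  have := (hasSum_psi (v := v) hQ hpos).mul_left (delta Q v c₁)
  rw [mul_one] at this
  exact (hasSum_iff_tsum_ofReal (fun y => mul_nonneg (delta_pos hQ h hpos).le
    (psi_pos hQ hpos y).le) (delta_pos hQ h hpos).le).1 this

theorem regenMatrix_nonRegen :
    regenMatrix (nonRegen Q v c₁) (toE (psi Q v)) (ENNReal.ofReal (delta Q v c₁)) = matE Q := by
  funext x y
  have h0 : 0 ≤ delta Q v c₁ * psi Q v y :=
    mul_nonneg (delta_pos hQ h hpos).le (psi_pos hQ hpos y).le
  have h1 : 0 ≤ Q x y - delta Q v c₁ * psi Q v y := by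
    rw [delta_mul_psi hQ]
    exact sub_nonneg.2 (h.lower x y)
  simp only [regenMatrix, toE, nonRegen, stepWeight, matE]
  rw [← ENNReal.ofReal_mul (delta_pos hQ h hpos).le, ← ENNReal.ofReal_add h0 h1]
  congr 1
  ring

/-- The constant is chosen so that its product with ψ(y) is c₂Q(v, y), the upper comparison bound.
-/
theorem isRegenerative_nonRegen : IsRegenerative (nonRegen Q v c₁) (toE (psi Q v))
    (ENNReal.ofReal (c₂ * ∑' w, Q v w)) where
  tsum_eq_one := by
    have := (hasSum_iff_tsum_ofReal (fun y => (psi_pos hQ hpos y).le) zero_le_one).1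
      (hasSum_psi (v := v) hQ hpos)
    simpa [toE] using this
  le x y := by
    simp only [nonRegen, stepWeight, toE]
    rw [← ENNReal.ofReal_mul' (psi_pos hQ hpos y).le]
    refine ENNReal.ofReal_le_ofReal ?_
    have h1 : c₂ * (∑' w, Q v w) * psi Q v y = c₂ * Q v y := by
      have := (tsum_row_pos (v := v) hQ hpos).ne'
      rw [psi]
      field_simp
    rw [h1]
    have := mul_nonneg (delta_pos hQ h hpos).le (psi_pos (v := v) hQ hpos y).le
    linarith [h.upper x y]
  act_one_le x := by
    have h1 : ∀ y, nonRegen Q v c₁ x y ≤ ENNReal.ofReal (Q x y) := fun y =>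
      ENNReal.ofReal_le_ofReal (sub_le_self _ (mul_nonneg (delta_pos hQ h hpos).le
        (psi_pos (v := v) hQ hpos y).le))
    calc act (nonRegen Q v c₁) 1 x = ∑' y, nonRegen Q v c₁ x y := by simp [act_apply]
      _ ≤ ∑' y, ENNReal.ofReal (Q x y) := ENNReal.tsum_le_tsum h1
      _ = ENNReal.ofReal (∑' y, Q x y) :=
        (ENNReal.ofReal_tsum_of_nonneg (hQ.nonneg x) (hQ.summable x)).symm
      _ ≤ 1 := ENNReal.ofReal_le_one.2 (hQ.tsum_le_one x)
  ne_top := ENNReal.ofReal_ne_top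

end Decomposition

theorem toE_toReal {f : S → ℝ≥0∞} (hf : ∀ x, f x ≠ ∞) : toE (fun x => (f x).toReal) = f :=
  funext fun x => ENNReal.ofReal_toReal (hf x)

theorem isUniquePosEigenvector_of_forall_eq_smul {T : Module.End ℝ≥0∞ (S → ℝ≥0∞)} {lam : ℝ}
    {f : S → ℝ≥0∞} (v : S) (hpos : ∀ x, f x ≠ 0) (hfin : ∀ x, f x ≠ ∞)
    (heq : T f = ENNReal.ofReal lam • f)
    (huniq : ∀ g : S → ℝ≥0∞, (∀ x, g x ≠ ∞) → T g = ENNReal.ofReal lam • g →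
      ∃ a : ℝ≥0∞, g = a • f) :
    IsUniquePosEigenvector T lam fun x => (f x).toReal := by
  refine ⟨fun x => ENNReal.toReal_pos (hpos x) (hfin x), by rwa [toE_toReal hfin], ?_⟩
  intro u' hu' he
  obtain ⟨a, ha⟩ := huniq (toE u') (fun x => ENNReal.ofReal_ne_top) he
  have h1 : ∀ x, u' x = a.toReal * (f x).toReal := fun x => by
    have := congrArg ENNReal.toReal (congrFun ha x)
    rwa [toE, ENNReal.toReal_ofReal (hu' x).le, Pi.smul_apply, smul_eq_mul,
      ENNReal.toReal_mul] at this
  refine ⟨a.toReal, ?_, h1⟩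
  have := hu' v
  rw [h1 v] at this
  exact pos_of_mul_pos_left this ENNReal.toReal_nonneg

/-! ### The vectors u_* and η_* as eigenvectors -/

section Stars

variable [Countable S] {Q : S → S → ℝ} (hQ : IsSubstochastic Q) {v : S} {c₁ c₂ : ℝ}
  (h : RowsComparable Q v c₁ c₂)

theorem expectPsi_eq_renewal (hpos : ∀ x y, 0 < Q x y) (θ : ℝ) :
    expectPsi hQ h (expRegen θ) = renewal (nonRegen Q v c₁) (toE (psi Q v))
      (ENNReal.ofReal (delta Q v c₁)) (ENNReal.ofReal (Real.exp θ)) := by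
  rw [expectPsi_expRegen_eq, tsum_delta_mul_psi hQ h hpos]

theorem existsUnique_expectPsi_eq_one (hpos : ∀ x y, 0 < Q x y) :
    ∃! θ : ℝ, expectPsi hQ h (expRegen θ) = 1 := by
  have hR := isRegenerative_nonRegen hQ h hpos
  have hδ0 : ENNReal.ofReal (delta Q v c₁) ≠ 0 :=
    (ENNReal.ofReal_pos.2 (delta_pos hQ h hpos)).ne'
  simp only [expectPsi_eq_renewal hQ h hpos]
  obtain ⟨z, hz0, hz, hr⟩ := hR.exists_renewal_eq_one hδ0 ENNReal.ofReal_ne_top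
  -- The substitution z = e^θ identifies real θ with the finite nonzero z.
  refine ⟨Real.log z.toReal, ?_, fun θ hθ => ?_⟩
  · beta_reduce
    rwa [Real.exp_log (ENNReal.toReal_pos hz0 hz), ENNReal.ofReal_toReal hz]
  · rw [← hR.eq_of_renewal_eq_one hδ0 ENNReal.ofReal_ne_top hθ hr,
      ENNReal.toReal_ofReal (Real.exp_pos θ).le, Real.log_exp]

variable {θ : ℝ}

/-- The vectors `u_*` and `η_*` as eigenvectors of `Q`, with bounds. -/
theorem stars_spec (hpos : ∀ x y, 0 < Q x y) (hθ : expectPsi hQ h (expRegen θ) = 1) :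
    (∀ x, uStar hQ h θ x ≠ ∞) ∧ (∀ y, etaStar hQ h θ y ≠ ∞) ∧
    IsUniquePosEigenvector (act (matE Q)) (Real.exp (-θ)) (fun x => (uStar hQ h θ x).toReal) ∧
    IsUniquePosEigenvector (act (transp (matE Q))) (Real.exp (-θ))
      (fun y => (etaStar hQ h θ y).toReal) ∧
    (∃ ι : ℝ, 0 < ι ∧ ∀ x, ι ≤ (uStar hQ h θ x).toReal) ∧
    (∃ U : ℝ, 0 < U ∧ ∀ x, (uStar hQ h θ x).toReal ≤ U) ∧
    (∃ H : ℝ, 0 < H ∧ ∀ y, (etaStar hQ h θ y).toReal ≤ H * psi Q v y) := by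
  have hR := isRegenerative_nonRegen hQ h hpos
  set A := nonRegen Q v c₁
  set ψ := toE (psi Q v) with hψ
  set δ := ENNReal.ofReal (delta Q v c₁) with hδ
  set z := ENNReal.ofReal (Real.exp θ) with hz
  have hδpos := delta_pos hQ h hpos
  have hδ0 : δ ≠ 0 := (ENNReal.ofReal_pos.2 hδpos).ne'
  have hδt : δ ≠ ∞ := ENNReal.ofReal_ne_top
  have hz0 : z ≠ 0 := (ENNReal.ofReal_pos.2 (Real.exp_pos θ)).ne'
  have hzt : z ≠ ∞ := ENNReal.ofReal_ne_top
  have hzinv : ENNReal.ofReal (Real.exp (-θ)) = z⁻¹ := by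
    rw [Real.exp_neg, ENNReal.ofReal_inv_of_pos (Real.exp_pos θ)]
  have hr : renewal A ψ δ z = 1 := by rw [← expectPsi_eq_renewal hQ h hpos, hθ]
  have hfin := IsRegenerative.pairing_ne_top_of_renewal hz0 hδ0 hr
  have hu : uStar hQ h θ = colVec A δ z := by
    rw [uStar_eq, tsum_delta_mul_psi hQ h hpos]
  have hη : etaStar hQ h θ = rowVec A ψ z := etaStar_eq hQ h θ
  have hreg : regenMatrix A ψ δ = matE Q := regenMatrix_nonRegen hQ h hpos
  set H := 1 + z * (ENNReal.ofReal (c₂ * ∑' w, Q v w) * pairing ψ (neumann z A 1)) with hH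
  have hHt : H ≠ ∞ := ENNReal.add_ne_top.2 ⟨ENNReal.one_ne_top,
    ENNReal.mul_ne_top hzt (ENNReal.mul_ne_top hR.ne_top hfin)⟩
  have hH0 : H ≠ 0 := (zero_lt_one.trans_le (le_self_add : 1 ≤ H)).ne'
  have hUt : δ * z * H ≠ ∞ := ENNReal.mul_ne_top (ENNReal.mul_ne_top hδt hzt) hHt
  have hcolt : ∀ x, colVec A δ z x ≠ ∞ := fun x => ne_top_of_le_ne_top hUt (hR.colVec_le x)
  have hrowt := hR.rowVec_ne_top hzt hfin
  have hι0 : δ * z ≠ 0 := mul_ne_zero hδ0 hz0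
  rw [hu, hη]
  refine ⟨hcolt, hrowt, ?_, ?_, ⟨(δ * z).toReal, ENNReal.toReal_pos hι0
    (ENNReal.mul_ne_top hδt hzt), fun x => ENNReal.toReal_mono (hcolt x) (le_colVec x)⟩,
    ⟨(δ * z * H).toReal, ENNReal.toReal_pos (mul_ne_zero hι0 hH0) hUt,
      fun x => ENNReal.toReal_mono hUt (hR.colVec_le x)⟩,
    ⟨H.toReal, ENNReal.toReal_pos hH0 hHt, fun y => ?_⟩⟩
  · refine isUniquePosEigenvector_of_forall_eq_smul v
      (fun x => ((pos_iff_ne_zero.2 hι0).trans_le (le_colVec x)).ne') hcolt ?_ fun g hg he => ?_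
    · rw [hzinv, ← hreg, IsRegenerative.act_colVec hz0 hzt hr]
    · rw [hzinv, ← hreg] at he
      exact ⟨_, (hR.eq_smul_colVec hδ0 hδt hz0 hzt hr v hg he).2⟩
  · refine isUniquePosEigenvector_of_forall_eq_smul v
      (fun y => ((ENNReal.ofReal_pos.2 (psi_pos hQ hpos y)).trans_le (le_rowVec y)).ne')
      hrowt ?_ fun g hg he => ?_
    · rw [hzinv, ← hreg, IsRegenerative.act_rowVec hz0 hzt hr]
    · rw [hzinv, ← hreg] at he
      obtain ⟨a, -, ha⟩ := hR.eq_smul_rowVec hδ0 hδt hz0 hzt hr hg he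
      exact ⟨a, ha⟩
  · have := ENNReal.toReal_mono (ENNReal.mul_ne_top hHt (hR.apply_ne_top y)) (hR.rowVec_le y)
    rwa [ENNReal.toReal_mul, hψ, toE, ENNReal.toReal_ofReal (psi_pos hQ hpos y).le] at this

end Stars

/-! ### From eigenvectors of the power to eigenvectors of the matrix -/

section Root

variable {B : S → S → ℝ} (hB : IsSubstochastic B) {m : ℕ} (hm : m ≠ 0) {lam : ℝ} (hlam : 0 < lam)
  (v : S) (hpos : ∀ x y, 0 < matPow B m x y)
include hB hm hlam v hpos

/-- Boundedness of u makes Bu finite; positivity of the power leaves no zero row in B, as seen by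
splitting off the first step. -/
theorem IsUniquePosEigenvector.col_root {u : S → ℝ} {U : ℝ} (hU : ∀ x, u x ≤ U)
    (h : IsUniquePosEigenvector (act (matE (matPow B m))) lam u) :
    IsUniquePosColEigenvector B (lam ^ (1 / (m : ℝ))) u := by
  rw [act_matPow hB] at h
  rw [isUniquePosColEigenvector_iff hB.nonneg (Real.rpow_nonneg hlam.le _)]
  refine h.root hm hlam v (fun x h0 => ?_) fun x => ?_
  · have h1 := hpos x v
    obtain ⟨k, rfl⟩ := Nat.exists_eq_succ_of_ne_zero hm
    rw [Nat.succ_eq_one_add] at h1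
    obtain ⟨w, hw, -⟩ := exists_pos_of_matPow_add_pos hB h1
    rw [matPow_one] at hw
    rw [act_apply, ENNReal.tsum_eq_zero] at h0
    exact mul_ne_zero (ENNReal.ofReal_pos.2 hw).ne' (ENNReal.ofReal_pos.2 (h.pos w)).ne' (h0 w)
  · refine ne_top_of_le_ne_top (b := ∑' y, matE B x y * ENNReal.ofReal U) ?_
      (ENNReal.tsum_le_tsum fun y => mul_le_mul_right (ENNReal.ofReal_le_ofReal (hU y)) _)
    rw [ENNReal.tsum_mul_right]
    simp only [matE]
    rw [← ENNReal.ofReal_tsum_of_nonneg (hB.nonneg x) (hB.summable x)]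
    exact ENNReal.mul_ne_top ENNReal.ofReal_ne_top ENNReal.ofReal_ne_top

/-- Summability of η replaces boundedness, and splitting off the last step excludes zero columns. -/
theorem IsUniquePosEigenvector.row_root {η : S → ℝ} (hη : Summable η)
    (h : IsUniquePosEigenvector (act (transp (matE (matPow B m)))) lam η) :
    IsUniquePosRowEigenvector B (lam ^ (1 / (m : ℝ))) η := by
  rw [act_transp_matPow hB] at h
  rw [isUniquePosRowEigenvector_iff hB.nonneg (Real.rpow_nonneg hlam.le _)]
  refine h.root hm hlam v (fun x h0 => ?_) fun x => ?_
  · have h1 := hpos v x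
    obtain ⟨k, rfl⟩ := Nat.exists_eq_succ_of_ne_zero hm
    rw [Nat.succ_eq_add_one] at h1
    obtain ⟨w, -, hw⟩ := exists_pos_of_matPow_add_pos hB h1
    rw [matPow_one] at hw
    rw [act_apply, ENNReal.tsum_eq_zero] at h0
    exact mul_ne_zero (ENNReal.ofReal_pos.2 hw).ne' (ENNReal.ofReal_pos.2 (h.pos w)).ne' (h0 w)
  · refine ne_top_of_le_ne_top (b := ∑' y, ENNReal.ofReal (η y)) ?_
      (ENNReal.tsum_le_tsum fun y => mul_le_of_le_one_left' ?_)
    · rw [← ENNReal.ofReal_tsum_of_nonneg (fun y => (h.pos y).le) hη]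
      exact ENNReal.ofReal_ne_top
    · exact ENNReal.ofReal_le_one.2 (hB.le_one y x)

end Root

end PerronFrobenius

end

theorem theorem6 {S : Type*} [Countable S] (B : S → S → ℝ) (hB : IsSubstochastic B)
    (hirr : IsIrred B) (m : ℕ) (hm : 1 ≤ m) (v : S) (c₁ c₂ : ℝ)
    (hA3 : RowsComparable (matPow B m) v c₁ c₂) :
    -- the equation for `θ` has exactly one solution
    (∃! θ : ℝ, expectPsi (hB.pow m) hA3 (expRegen θ) = 1) ∧
    -- and, for this solution:
    ∀ θ : ℝ, expectPsi (hB.pow m) hA3 (expRegen θ) = 1 →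
      -- `u_*` and `η_*` are finite-valued
      (∀ x, uStar (hB.pow m) hA3 θ x ≠ ∞) ∧ (∀ y, etaStar (hB.pow m) hA3 θ y ≠ ∞) ∧
      ∀ (lam : ℝ) (u η : S → ℝ), lam = Real.exp (-θ) →
        (∀ x, u x = (uStar (hB.pow m) hA3 θ x).toReal) →
        (∀ y, η y = (etaStar (hB.pow m) hA3 θ y).toReal) →
        -- the eigenvector properties of `B ^ m`
        IsUniquePosColEigenvector (matPow B m) lam u ∧
        IsUniquePosRowEigenvector (matPow B m) lam η ∧
        (Summable fun w => u w * η w) ∧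
        -- the asymptotics of the powers of `B`
        (∀ x y, Asymptotics.IsEquivalent atTop (fun n : ℕ => matPow B n x y)
          (fun n : ℕ => lam ^ ((n : ℝ) / (m : ℝ)) * (u x * η y / ∑' w, u w * η w))) ∧
        -- the eigenvectors of `B`
        IsUniquePosColEigenvector B (lam ^ (1 / (m : ℝ))) u ∧
        IsUniquePosRowEigenvector B (lam ^ (1 / (m : ℝ))) η := by
  have hpos := hirr.matPow_pos hB hA3
  have hQ := hB.pow m
  have hm0 : m ≠ 0 := by omega
  refine ⟨existsUnique_expectPsi_eq_one hQ hA3 hpos, fun θ hθ => ?_⟩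
  obtain ⟨hut, hηt, hu, hη, ⟨ι, hι, hιu⟩, ⟨U, hU, hUu⟩, ⟨H, hH, hHη⟩⟩ :=
    stars_spec hQ hA3 hpos hθ
  refine ⟨hut, hηt, fun lam u η hlam hueq hηeq => ?_⟩
  obtain rfl : u = fun x => (uStar hQ hA3 θ x).toReal := funext hueq
  obtain rfl : η = fun y => (etaStar hQ hA3 θ y).toReal := funext hηeq
  rw [← hlam] at hu hη
  set u : S → ℝ := fun x => (uStar hQ hA3 θ x).toReal
  set η : S → ℝ := fun y => (etaStar hQ hA3 θ y).toReal
  have hlam0 : 0 < lam := hlam ▸ Real.exp_pos _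
  have hηs : Summable η := Summable.of_nonneg_of_le (fun y => (hη.pos y).le) hHη
    ((hasSum_psi hQ hpos).summable.mul_left H)
  have hs : Summable fun w => u w * η w := Summable.of_nonneg_of_le
    (fun w => mul_nonneg (hu.pos w).le (hη.pos w).le)
    (fun w => mul_le_mul_of_nonneg_right (hUu w) (hη.pos w).le) (hηs.mul_left U)
  have hs0 : 0 < ∑' w, u w * η w := hs.tsum_pos (fun w => mul_nonneg (hu.pos w).le (hη.pos w).le) v
    (mul_pos (hu.pos v) (hη.pos v))
  have hcol := (isUniquePosColEigenvector_iff hQ.nonneg hlam0.le).2 hu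
  have hrow := (isUniquePosRowEigenvector_iff hQ.nonneg hlam0.le).2 hη
  have hcolB := hu.col_root hB hm0 hlam0 v hpos hUu
  have hrowB := hη.row_root hB hm0 hlam0 v hpos hηs
  refine ⟨hcol, hrow, hs, fun x y => ?_, hcolB, hrowB⟩
  set μ := lam ^ (1 / (m : ℝ)) with hμ
  have hμ0 : 0 < μ := Real.rpow_pos_of_pos hlam0 _
  have hμm : μ ^ m = lam := by rw [hμ, one_div, Real.rpow_inv_natCast_pow hlam0.le hm0]
  have hpow : ∀ n : ℕ, lam ^ ((n : ℝ) / (m : ℝ)) = μ ^ n := fun n => by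
    rw [hμ, ← Real.rpow_natCast, ← Real.rpow_mul hlam0.le]
    congr 1
    ring
  have hδ := delta_pos hQ hA3 hpos
  -- The constant δ/(UH) cancels u ≤ U and η ≤ Hψ, leaving δψ, the regenerative part of the matrix.
  have hmin : ∀ x y, delta (matPow B m) v c₁ / (U * H) * u x * η y ≤ matPow B m x y := by
    intro x y
    have h1 := (hu.pos x).le
    have h2 := (hη.pos y).le
    calc delta (matPow B m) v c₁ / (U * H) * u x * η y
        ≤ delta (matPow B m) v c₁ / (U * H) * U * (H * psi (matPow B m) v y) := by
          gcongr
          · exact hUu x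
          · exact hHη y
      _ = delta (matPow B m) v c₁ * psi (matPow B m) v y := by field_simp
      _ = c₁ * matPow B m v y := delta_mul_psi hQ v y c₁
      _ ≤ matPow B m x y := hA3.lower x y
  have hlim := tendsto_matPow_div_pow hB (Nat.pos_of_ne_zero hm0) hμ0 hrowB.1 (hμm ▸ hcol.1)
    hs.hasSum hs0 (div_pos hδ (mul_pos hU hH)) hmin hι hιu x y
  have hne : u x * η y / ∑' w, u w * η w ≠ 0 :=
    (div_pos (mul_pos (hu.pos x) (hη.pos y)) hs0).ne'
  simp only [hpow]
  have h1 := ((Asymptotics.isEquivalent_const_iff_tendsto hne).2 hlim)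
  refine ((Asymptotics.IsEquivalent.refl (u := fun n : ℕ => μ ^ n)).mul h1).congr_left ?_
  refine .of_forall fun n => ?_
  have := (pow_pos hμ0 n).ne'
  simp only [Pi.mul_apply]
  field_simp
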